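/- **Theorem 1.11.** For an integral quadratic form $q(X)=\sum_{1\le i\le j\le m}q_{ij}x_ix_j$ ($q_{ij}\in\mathbb Z$) let $Q=(q_{ij})+{}^t(q_{ij})$ be its matrix, so that $2q(X)={}^tXQX$, and let $\det q=\det Q$; $q$ is nonsingular if $\det q\neq0$. For integral quadratic forms $q,q'$ in $m$ variables write $R(q,q')$ for the set of $A\in M_m(\mathbb Z)$ with $q(AY)=q'(Y)$ identically in $Y$, write $R^*(q,q')$ for the set of those $A\in R(q,q')$ whose entries are jointly coprime, and let $E(q)=R(q,q)\cap GL_m(\mathbb Z)$. The form $q'$ is similar to $q$ if $\det q'=\det q$ and $R(q,aq')\ne\emptyset$ for some integer $a$ prime to $\det q$; the similarity class of $q$ consists of all integral forms in $m$ variables similar to $q$. Two forms $q',q''$ are (integrally) equivalent if $q''(Y)=q'(UY)$ for some $U\in GL_m(\mathbb Z)$. Let $q$ be a nonsingular integral quadratic form in $m=2k+1\ge 3$ variables and let $p$ be a prime not dividing $\det q$. Let $(q_i)_{i\in I}$ be a complete system of representatives of the different equivalence classes contained in the similarity class of $q$. Let $K\in\mathbb Z^m$ be a column with $q(K)\equiv0\pmod{p^2}$.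 Say that a matrix $M\in M_m(\mathbb Z)$ divides $K$, written $M\mid K$, if $K=ML$ for some $L\in\mathbb Z^m$; for $M\in R^*(q,p^2q_i)$ this depends only on the class $M\,E(q_i)$. Then the number of all classes (over all $i\in I$) in $R^*(q,p^2q_i)/E(q_i)$ that divide $K$ is finite, and $$ \sum_{i\in I}\ \sum_{\substack{M\in R^*(q,p^2q_i)/E(q_i)\\ M\mid K}}1 = c_p\cdot\Bigl\{1+\bigl(\varepsilon_p\,\chi_q(p)\,p^{k-1}+c_p^{-1}\beta_p\bigr)\,\delta(p^{-1}K)+p^{m-2}\,\delta(p^{-2}K)\Bigr\}. $$ Here $\varepsilon_p=\left(\frac{2\,q(p^{-1}K)}{p}\right)$, with $q(p^{-1}K)=p^{-2}q(K)\in\mathbb Z$, and $\chi_q(p)=\left(\frac{(-1)^k\det q}{p}\right)$ are Legendre symbols; $\delta(X)=1$ if the column $X\in\mathbb Q^m$ is integral and $\delta(X)=0$ otherwise; and $$ c_p=\sum_{a=1}^{k}p^{1-a}\prod_{i=1}^{a-1}\frac{p^{2(k-i)}-1}{1-p^{-i}},\qquad \beta_p=\sum_{a=1}^{k}\left(\prod_{i=1}^{a-1}\frac{p^{2(k-i)}-1}{1-p^{-i}}\right)\frac{p^{m-2}-p^{a-1}(p+1)+1}{p^{a-1}(p^a-1)}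 . $$ -/

import Mathlib

namespace IntQuad

/-- The matrix `Q` of an integral quadratic form `q = ∑_{i ≤ j} q_{ij} x_i x_j`, i.e. `(q_{ij}) + ᵗ(q_{ij})`:
its off-diagonal entries are the coefficients of the `x_i x_j`, its diagonal entries are twice the coefficients of the
`x_i ^ 2`, and `2 q(X) = ᵗX Q X`. -/
def gram {m : ℕ} (q : QuadraticForm ℤ (Fin m → ℤ)) : Matrix (Fin m) (Fin m) ℤ :=
  Matrix.of fun i j => QuadraticMap.polar q (Pi.single i 1) (Pi.single j 1)

/-- The determinant of an integral quadratic form: the determinant of its matrix. -/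
def formDet {m : ℕ} (q : QuadraticForm ℤ (Fin m → ℤ)) : ℤ := (gram q).det

/-- `q[A]`, the quadratic form `Y ↦ q(A Y)`. -/
def subst {m n : ℕ} (q : QuadraticForm ℤ (Fin m → ℤ)) (A : Matrix (Fin m) (Fin n) ℤ) :
    QuadraticForm ℤ (Fin n → ℤ) :=
  q.comp A.mulVecLin

/-- `R(q, q')`: the integral representations of `q'` by `q`. -/
def Rep {m n : ℕ} (q : QuadraticForm ℤ (Fin m → ℤ)) (q' : QuadraticForm ℤ (Fin n → ℤ)) :
    Set (Matrix (Fin m) (Fin n) ℤ) :=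
  {A | subst q A = q'}

/-- `R*(q, q')`: the representations whose entries are (jointly) coprime. -/
def PrimRep {m n : ℕ} (q : QuadraticForm ℤ (Fin m → ℤ)) (q' : QuadraticForm ℤ (Fin n → ℤ)) :
    Set (Matrix (Fin m) (Fin n) ℤ) :=
  {A | A ∈ Rep q q' ∧ ∀ d : ℤ, (∀ i j, d ∣ A i j) → IsUnit d}

/-- `E(q)`: the group of units of `q`, as a subgroup of `GL_m(ℤ)`. -/
def unitGroup {m : ℕ} (q : QuadraticForm ℤ (Fin m → ℤ)) : Subgroup (GL (Fin m) ℤ) where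
  carrier := {U | (U : Matrix (Fin m) (Fin m) ℤ) ∈ Rep q q}
  one_mem' := by
    ext x
    simp [subst]
  mul_mem' := by
    intro U V hU hV
    ext x
    have h1 := DFunLike.congr_fun hU ((V : Matrix (Fin m) (Fin m) ℤ).mulVec x)
    have h2 := DFunLike.congr_fun hV x
    simp only [subst, QuadraticMap.comp_apply, Matrix.mulVecLin_apply] at h1 h2 ⊢
    rw [Units.val_mul, ← Matrix.mulVec_mulVec, h1, h2]
  inv_mem' := by
    intro U hU
    ext x
    have h1 := DFunLike.congr_fun hU (((U⁻¹ : GL (Fin m) ℤ) : Matrix (Fin m) (Fin m) ℤ).mulVec x)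
    simp only [subst, QuadraticMap.comp_apply, Matrix.mulVecLin_apply] at h1 ⊢
    rw [← h1, Matrix.mulVec_mulVec, ← Units.val_mul, mul_inv_cancel, Units.val_one, Matrix.one_mulVec]

/-- `q'` is similar to `q`: the determinants are equal and `R(q, a q')` is not empty for some `a` prime to `det q`. -/
def Similar {m : ℕ} (q q' : QuadraticForm ℤ (Fin m → ℤ)) : Prop :=
  formDet q' = formDet q ∧ ∃ a : ℤ, IsCoprime a (formDet q) ∧ (Rep q (a • q')).Nonempty

/-- The family `r` is a complete system of representatives of the different classes of integrally equivalent forms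
contained in the similarity class of `q`. -/
structure IsCompleteSystem {m : ℕ} {ι : Type*} (q : QuadraticForm ℤ (Fin m → ℤ))
    (r : ι → QuadraticForm ℤ (Fin m → ℤ)) : Prop where
  similar : ∀ i, Similar q (r i)
  inequivalent : ∀ i j, (r i).Equivalent (r j) → i = j
  exhaustive : ∀ q', Similar q q' → ∃ i, q'.Equivalent (r i)

/-- Right multiplication by units: `M ∼ M U` with `U ∈ E(q')`, on `R*(q, a q')`. -/
def autSetoid {m : ℕ} (q q' : QuadraticForm ℤ (Fin m → ℤ)) (a : ℤ) : Setoid (PrimRep q (a • q')) where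
  r M N := ∃ U ∈ unitGroup q', (N : Matrix (Fin m) (Fin m) ℤ) = M.1 * (U : Matrix (Fin m) (Fin m) ℤ)
  iseqv :=
    { refl := fun M => ⟨1, one_mem _, by simp⟩
      symm := by
        rintro M N ⟨U, hU, h⟩
        refine ⟨U⁻¹, inv_mem hU, ?_⟩
        rw [h, Matrix.mul_assoc, ← Units.val_mul, mul_inv_cancel, Units.val_one, Matrix.mul_one]
      trans := by
        rintro M N P ⟨U, hU, h⟩ ⟨V, hV, h'⟩
        exact ⟨U * V, mul_mem hU hV, by rw [h', h, Units.val_mul, Matrix.mul_assoc]⟩ }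

/-- `R*(q, a q') / E(q')`: the classes of primitive automorphs of `q` to `q'` with multiplier `a`. -/
def AutClass {m : ℕ} (q q' : QuadraticForm ℤ (Fin m → ℤ)) (a : ℤ) : Type := Quotient (autSetoid q q' a)

/-- `M ∣ K`: the matrix `M` divides the column `K` from the left. -/
def LeftDvd {m n : ℕ} (M : Matrix (Fin m) (Fin n) ℤ) (K : Fin m → ℤ) : Prop :=
  ∃ L : Fin n → ℤ, K = M.mulVec L

theorem LeftDvd.mul_unit {m n : ℕ} {M : Matrix (Fin m) (Fin n) ℤ} {K : Fin m → ℤ} (h : LeftDvd M K)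
    (U : GL (Fin n) ℤ) : LeftDvd (M * (U : Matrix (Fin n) (Fin n) ℤ)) K := by
  obtain ⟨L, rfl⟩ := h
  refine ⟨((U⁻¹ : GL (Fin n) ℤ) : Matrix (Fin n) (Fin n) ℤ).mulVec L, ?_⟩
  rw [Matrix.mulVec_mulVec, Matrix.mul_assoc, ← Units.val_mul, mul_inv_cancel, Units.val_one, Matrix.mul_one]

/-- A class of automorphs divides `K` from the left if its members do. -/
def AutClass.LeftDvd {m : ℕ} {q q' : QuadraticForm ℤ (Fin m → ℤ)} {a : ℤ} (c : AutClass q q' a) (K : Fin m → ℤ) :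
    Prop :=
  Quotient.liftOn c (fun M => IntQuad.LeftDvd M.1 K) (by
    intro M N hMN
    have key : ∀ M N : PrimRep q (a • q'), (autSetoid q q' a).r M N →
        IntQuad.LeftDvd M.1 K → IntQuad.LeftDvd N.1 K := by
      rintro M N ⟨U, -, h⟩ hM
      rw [h]
      exact hM.mul_unit U
    exact propext ⟨key M N hMN, key N M ((autSetoid q q' a).symm hMN)⟩)

/-- `c_p = ∑_{a=1}^{k} p^{1-a} ∏_{i=1}^{a-1} (p^{2(k-i)} - 1) / (1 - p^{-i})`. -/
def cConst (p k : ℕ) : ℚ :=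
  ∑ a ∈ Finset.Icc 1 k,
    (∏ i ∈ Finset.Icc 1 (a - 1), ((p : ℚ) ^ (2 * (k - i)) - 1) / (1 - (p : ℚ) ^ (-(i : ℤ)))) *
      (p : ℚ) ^ (1 - (a : ℤ))

/-- `β_p = ∑_{a=1}^{k} (∏_{i=1}^{a-1} (p^{2(k-i)} - 1) / (1 - p^{-i})) ·
(p^{m-2} - p^{a-1}(p+1) + 1) / (p^{a-1}(p^a - 1))`, where `m = 2k+1`. -/
def betaConst (p k : ℕ) : ℚ :=
  ∑ a ∈ Finset.Icc 1 k,
    (∏ i ∈ Finset.Icc 1 (a - 1), ((p : ℚ) ^ (2 * (k - i)) - 1) / (1 - (p : ℚ) ^ (-(i : ℤ)))) *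
      (((p : ℚ) ^ (2 * k + 1 - 2) - (p : ℚ) ^ (a - 1) * ((p : ℚ) + 1) + 1) /
        ((p : ℚ) ^ (a - 1) * ((p : ℚ) ^ a - 1)))

/-- The character `χ_q(p)`, the Legendre symbol of `(-1)^k det q` modulo `p`, for a form in `2k` or `2k+1` variables. -/
def chi {m : ℕ} (q : QuadraticForm ℤ (Fin m → ℤ)) (p : ℕ) [Fact p.Prime] : ℤ :=
  legendreSym p ((-1) ^ (m / 2) * formDet q)

/-- `ε_p(a)`, the Legendre symbol of `2a` modulo `p`. -/
def eps (p : ℕ) [Fact p.Prime] (a : ℤ) : ℤ := legendreSym p (2 * a)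

open Classical in
/-- `δ(X)`: `1` if the rational column `X` is integral, `0` otherwise. -/
noncomputable def delta {m : ℕ} (X : Fin m → ℚ) : ℚ :=
  if ∃ Y : Fin m → ℤ, ∀ i, X i = (Y i : ℚ) then 1 else 0

end IntQuad

/-! Put L = ℤ^m and let B be the polar form of q, so that B(x, x) = 2q(x). Sending M to Λ = Mℤ^m
turns the classes over all i into the sublattices Λ ⊂ L on which p⁻²B is integral and unimodular at
p and which do not lie in pL; the last condition expresses coprimality of the entries. Units do not
change Λ, completeness of the system gives exactly one i for each Λ, and M ∣ K means K ∈ Λ. This is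
`bijective_lattice`, and the task becomes counting good lattices through K.

The image U of such a Λ in L/pL is totally isotropic of some dimension a with 1 ≤ a ≤ k, and py ∈ Λ
exactly when y mod p lies in U^⊥. Thus Λ is spanned by lifts of a basis of U together with p times
the preimage of U^⊥. Adjoining the lifts one at a time and double counting pairs (lattice, next
generator modulo p²) gives the product formula `ncard_goodThrough`. Its only real input is the
number of vectors that enlarge a given totally isotropic subspace.

That number is a count of zeros in an orthogonal complement. The excess |F|·#zeros − #vectors does
not change on passing to the orthogonal complement of a totally isotropic subspace
(`excess_inf_orthogonal`), so only two excesses are needed. That of the whole odd-dimensional space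
is 0 (`excess_top`), and that of X^⊥ for anisotropic X is a Gauss sum computation
(`excess_orthogonal`), the source of ε_p χ_q(p).

If K ∉ pL, then K serves as the first generator and the count is c_p. If K = pX, then K ∈ Λ means
that U is orthogonal to X. For X ≡ 0 this is no condition; for X isotropic and nonzero modulo p the
lattices are split according to X ∈ U or X ∉ U; for X anisotropic the character enters. Summing over
a gives c_p + β_p in each of these three cases, with the additional term p^{m-2} c_p in the first
and ε_p χ_q(p) p^{k-1} c_p in the last. -/

namespace IntQuad

/-! ### The excess of zeros of a quadratic form on a subspace. -/

section Excess

variable {F V : Type*} [Field F] [Finite F] [AddCommGroup V] [Module F V] [Finite V]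

/-- The zeros in the subspace `A` of the quadratic form `x ↦ b x x`. -/
def zeros (b : LinearMap.BilinForm F V) (A : Submodule F V) : Set V := {x | x ∈ A ∧ b x x = 0}

/-- `|F|` times the number of zeros in `A`, minus `|A|`. -/
noncomputable def excess (b : LinearMap.BilinForm F V) (A : Submodule F V) : ℤ :=
  Nat.card F * (zeros b A).ncard - (A : Set V).ncard

/-- The subspace `W` is totally isotropic. -/
def TotIso (b : LinearMap.BilinForm F V) (W : Submodule F V) : Prop := ∀ x ∈ W, ∀ y ∈ W, b x y = 0

omit [Finite F] [Finite V] in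
theorem orthogonal_sup {b : LinearMap.BilinForm F V} (M N : Submodule F V) :
    b.orthogonal (M ⊔ N) = b.orthogonal M ⊓ b.orthogonal N := by
  apply le_antisymm
  · exact le_inf (LinearMap.BilinForm.orthogonal_le le_sup_left) (LinearMap.BilinForm.orthogonal_le le_sup_right)
  · rintro x ⟨hx, hx'⟩ y hy
    obtain ⟨y, hyM, z, hz, rfl⟩ := Submodule.mem_sup.1 hy
    have e1 : b y x = 0 := hx y hyM
    have e2 : b z x = 0 := hx' z hz
    simp [e1, e2]

-- Only vectors not orthogonal to u are removed. On a line y + Fu with b(u, y) ≠ 0 the form is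
-- affine in the parameter with slope 2b(u, y) ≠ 0, so exactly one of its |F| points is a zero. The
-- removed part therefore contributes nothing to the excess.
omit [Finite F] in
theorem excess_inf_orthogonal_singleton {b : LinearMap.BilinForm F V} (hb : b.IsSymm) (h2 : (2 : F) ≠ 0)
    {A : Submodule F V} {u : V} (hu : u ∈ A) (huu : b u u = 0) :
    excess b (A ⊓ b.orthogonal (F ∙ u)) = excess b A := by
  have hsymm : ∀ x y, b x y = b y x := fun x y => hb.eq x y
  set t : Set V := {x | b u x = 0} with ht
  have horth : ∀ x, x ∈ b.orthogonal (F ∙ u) ↔ b u x = 0 := by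
    intro x
    rw [LinearMap.BilinForm.mem_orthogonal_iff]
    constructor
    · intro h
      exact h u (Submodule.mem_span_singleton_self u)
    · intro h y hy
      obtain ⟨c, rfl⟩ := Submodule.mem_span_singleton.1 hy
      simp [h]
  have h1 : zeros b (A ⊓ b.orthogonal (F ∙ u)) = zeros b A ∩ t := by
    ext x
    simp only [zeros, Submodule.mem_inf, horth, Set.mem_ofPred_eq, Set.mem_inter_iff, ht]
    tauto
  have h2' : ((A ⊓ b.orthogonal (F ∙ u) : Submodule F V) : Set V) = (A : Set V) ∩ t := by
    ext x
    simp [horth, ht]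
  have e1 := Set.ncard_inter_add_ncard_sdiff_eq_ncard (zeros b A) t (Set.toFinite _)
  have e2 := Set.ncard_inter_add_ncard_sdiff_eq_ncard (A : Set V) t (Set.toFinite _)
  have key : Nat.card F * (zeros b A \ t).ncard = ((A : Set V) \ t).ncard := by
    rw [← Nat.card_coe_set_eq, ← Nat.card_coe_set_eq, ← Nat.card_prod]
    refine Nat.card_eq_of_bijective
      (fun z : F × ↥(zeros b A \ t) => (⟨z.2.1 + z.1 • u, ?_, ?_⟩ : ↥((A : Set V) \ t))) ⟨?_, ?_⟩
    · exact A.add_mem z.2.2.1.1 (A.smul_mem _ hu)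
    · have := z.2.2.2
      simpa [ht, huu] using this
    · rintro ⟨c, x, ⟨hxA, hx⟩, hxt⟩ ⟨d, y, ⟨hyA, hy⟩, hyt⟩ h
      replace h : x + c • u = y + d • u := congrArg Subtype.val h
      have hxy : x = y + (d - c) • u := by
        rw [sub_smul, ← add_sub_assoc, ← h]; abel
      have : b x x = (d - c) * (2 * b u y) := by
        rw [hxy]
        simp only [map_add, map_smul, LinearMap.add_apply, LinearMap.smul_apply, smul_eq_mul, hy, huu, hsymm y u]
        ring
      have hdc : d - c = 0 := by
        rw [hx, eq_comm, mul_eq_zero] at this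
        exact this.resolve_right (mul_ne_zero h2 hyt)
      refine Prod.ext (sub_eq_zero.1 hdc).symm (Subtype.ext ?_)
      rw [hdc, zero_smul, add_zero] at hxy
      exact hxy
    · rintro ⟨y, hyA, hyt⟩
      have hyt' : b u y ≠ 0 := hyt
      -- The value c = b(y, y) / 2b(u, y) is the unique one for which y − cu is isotropic.
      refine ⟨⟨b y y / (2 * b u y), y - (b y y / (2 * b u y)) • u, ⟨A.sub_mem hyA (A.smul_mem _ hu), ?_⟩, ?_⟩, ?_⟩
      · simp only [map_sub, map_smul, LinearMap.sub_apply, LinearMap.smul_apply, smul_eq_mul, huu, hsymm y u]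
        field_simp
        ring
      · simpa [ht, huu] using hyt'
      · simp
  unfold excess
  rw [h1, h2']
  have key' : (Nat.card F : ℤ) * (zeros b A \ t).ncard = ((A : Set V) \ t).ncard := by exact_mod_cast key
  rw [← e1, ← e2]
  push_cast
  linarith

-- Cut by the generators of U in turn. Total isotropy keeps the remaining generators inside each
-- successive cut, so the one-vector case applies every time.
omit [Finite F] in
theorem excess_inf_orthogonal {b : LinearMap.BilinForm F V} (hb : b.IsSymm) (h2 : (2 : F) ≠ 0)
    {U : Submodule F V} (hU : TotIso b U) : ∀ {A : Submodule F V}, U ≤ A →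
    excess b (A ⊓ b.orthogonal U) = excess b A := by
  have hfg : U.FG := IsNoetherian.noetherian U
  induction U, hfg using Submodule.fg_induction with
  | singleton u =>
    intro A hA
    have hu := Submodule.mem_span_singleton_self (R := F) u
    exact excess_inf_orthogonal_singleton hb h2 (hA hu) (hU u hu u hu)
  | sup M N _ _ ihM ihN =>
    intro A hA
    have hM : TotIso b M := fun x hx y hy => hU x (Submodule.mem_sup_left hx) y (Submodule.mem_sup_left hy)
    have hN : TotIso b N := fun x hx y hy => hU x (Submodule.mem_sup_right hx) y (Submodule.mem_sup_right hy)
    rw [orthogonal_sup, ← inf_assoc, ihN hN, ihM hM (le_sup_left.trans hA)]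
    refine le_inf (le_sup_right.trans hA) fun x hx y hy => ?_
    exact hU y (Submodule.mem_sup_left hy) x (Submodule.mem_sup_right hx)

end Excess

/-! ### Quadratic Gauss sums and exponential sums of diagonal forms. -/

section Gauss

open Finset

variable {F : Type*} [Field F] [Fintype F] [DecidableEq F]

/-- The quadratic character with complex values. -/
noncomputable def quadCharC (F : Type*) [Field F] [Fintype F] [DecidableEq F] : MulChar F ℂ :=
  (quadraticChar F).ringHomComp (Int.castRingHom ℂ)

theorem quadCharC_apply (a : F) : quadCharC F a = (quadraticChar F a : ℂ) := rfl

theorem quadCharC_ne_one (hF : ringChar F ≠ 2) : quadCharC F ≠ 1 := by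
  obtain ⟨a, ha⟩ := quadraticChar_exists_neg_one' hF
  intro h
  have := congrArg (fun χ => χ (a : F)) h
  simp only [quadCharC_apply, ha, MulChar.one_apply_coe] at this
  norm_num at this

theorem gaussSum_quadCharC_sq (hF : ringChar F ≠ 2) {ψ : AddChar F ℂ} (hψ : ψ.IsPrimitive) :
    gaussSum (quadCharC F) ψ ^ 2 = (quadraticChar F (-1) : ℂ) * Fintype.card F :=
  gaussSum_sq (quadCharC_ne_one hF) ((quadraticChar_isQuadratic F).comp _) hψ

/-- Group the t by y = t²: there are 1 + χ(y) square roots of y. The constant 1 sums to zero against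
a nontrivial character, and χ(y) leaves a twisted Gauss sum. -/
theorem sum_addChar_mul_sq (hF : ringChar F ≠ 2) {ψ : AddChar F ℂ} (hψ : ψ.IsPrimitive) {c : F} (hc : c ≠ 0) :
    ∑ t, ψ (c * t ^ 2) = (quadraticChar F c : ℂ) * gaussSum (quadCharC F) ψ := by
  have h1 : ∑ t, ψ (c * t ^ 2) = ∑ y, ((quadraticChar F y : ℂ) + 1) * ψ (c * y) := by
    rw [← Finset.sum_fiberwise_of_maps_to (s := univ) (t := univ) (g := fun t : F => t ^ 2) (fun _ _ => mem_univ _)]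
    refine Finset.sum_congr rfl fun y _ => ?_
    rw [Finset.sum_congr rfl (g := fun _ => ψ (c * y))]
    · rw [Finset.sum_const, nsmul_eq_mul]
      congr 1
      have := quadraticChar_card_sqrts hF y
      rw [Set.toFinset_ofPred] at this
      exact_mod_cast this
    · intro t ht
      rw [(Finset.mem_filter.1 ht).2]
  rw [h1]
  simp only [add_mul, one_mul, Finset.sum_add_distrib]
  have h2 : ∑ y, ψ (c * y) = 0 := by
    have := AddChar.sum_mulShift c hψ
    rw [if_neg hc] at this
    simpa [mul_comm] using this
  rw [h2, add_zero]
  have h3 := gaussSum_mulShift (quadCharC F) ψ (Units.mk0 c hc)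
  rw [← h3, ← mul_assoc, quadCharC_apply, Units.val_mk0]
  have h4 : (quadraticChar F c : ℂ) * (quadraticChar F c : ℂ) = 1 := by
    rw [← pow_two]
    exact_mod_cast quadraticChar_sq_one hc
  rw [h4, one_mul, gaussSum]
  refine Finset.sum_congr rfl fun y _ => ?_
  simp [quadCharC_apply, AddChar.mulShift_apply]

variable {V : Type*} [AddCommGroup V] [Module F V] [Fintype V]

-- Orthogonality of additive characters: summing ψ(ts) over t detects s = 0.
omit [Fintype V] in
theorem card_mul_ncard_zeros {ψ : AddChar F ℂ} (hψ : ψ.IsPrimitive) (b : LinearMap.BilinForm F V)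
    (A : Submodule F V) [Fintype A] :
    (Fintype.card F : ℂ) * (zeros b A).ncard = ∑ t : F, ∑ x : A, ψ (t * b x x) := by
  rw [Finset.sum_comm]
  simp only [AddChar.sum_mulShift _ hψ]
  have : (zeros b A).ncard = #{x : A | b (x : V) (x : V) = 0} := by
    rw [← Set.ncard_coe_finset, ← Set.ncard_image_of_injective _ (Subtype.val_injective (p := fun x => x ∈ A))]
    congr 1
    ext x
    simp [zeros, and_comm]
  rw [this, ← Finset.sum_filter_add_sum_filter_not univ (fun x : A => b (x : V) (x : V) = 0)]
  rw [Finset.sum_congr rfl (g := fun _ => (Fintype.card F : ℂ)), Finset.sum_const,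
    Finset.sum_congr (s₁ := filter (fun x : A => ¬ b (x : V) (x : V) = 0) univ) rfl (g := fun _ => (0 : ℂ))]
  · simp [mul_comm]
  · intro x hx
    rw [if_neg (Finset.mem_filter.1 hx).2]; simp
  · intro x hx
    rw [if_pos (Finset.mem_filter.1 hx).2]

omit [Fintype F] [DecidableEq F] in
theorem map_sum_addChar {ι : Type*} (ψ : AddChar F ℂ) (s : Finset ι) (f : ι → F) :
    ψ (∑ i ∈ s, f i) = ∏ i ∈ s, ψ (f i) := by
  classical
  induction s using Finset.induction_on with
  | empty => simp
  | insert i s hi ih => rw [Finset.sum_insert hi, Finset.prod_insert hi, AddChar.map_add_eq_mul, ih]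

theorem sum_addChar_orthogonal_basis {n : ℕ} (hF : ringChar F ≠ 2) {ψ : AddChar F ℂ} (hψ : ψ.IsPrimitive)
    {b : LinearMap.BilinForm F V} (v : Module.Basis (Fin n) F V) (hv : b.iIsOrtho v) (hv0 : ∀ i, b (v i) (v i) ≠ 0)
    {t : F} (ht : t ≠ 0) :
    ∑ x, ψ (t * b x x) =
      (quadraticChar F t : ℂ) ^ n * (quadraticChar F (∏ i, b (v i) (v i)) : ℂ) * gaussSum (quadCharC F) ψ ^ n := by
  have h1 : ∀ c : Fin n → F, ψ (t * b (v.equivFun.symm c) (v.equivFun.symm c)) =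
      ∏ i, ψ (t * b (v i) (v i) * c i ^ 2) := by
    intro c
    rw [← map_sum_addChar]
    congr 1
    simp only [Module.Basis.equivFun_symm_apply, map_sum, LinearMap.sum_apply, map_smul, LinearMap.smul_apply,
      smul_eq_mul, Finset.mul_sum]
    refine Finset.sum_congr rfl fun i _ => ?_
    rw [Finset.sum_eq_single i]
    · ring
    · intro j _ hj
      have : b (v i) (v j) = 0 := hv hj.symm
      have : b (v j) (v i) = 0 := hv hj
      simp [*]
    · simp
  rw [← Equiv.sum_comp v.equivFun.symm.toEquiv]
  simp only [LinearEquiv.coe_toEquiv, h1]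
  have h2 := Finset.prod_univ_sum (fun _ : Fin n => (univ : Finset F))
    (fun i c => ψ (t * b (v i) (v i) * c ^ 2))
  rw [Fintype.piFinset_univ] at h2
  rw [← h2]
  simp only [fun i => sum_addChar_mul_sq hF hψ (mul_ne_zero ht (hv0 i)), map_mul, map_prod, Int.cast_mul, Int.cast_prod,
    Finset.prod_mul_distrib, Finset.prod_const, Finset.card_univ, Fintype.card_fin]

end Gauss

end IntQuad

/-! ### Gauss sum evaluation of the excess for nondegenerate forms. -/

namespace IntQuad

open Finset

variable {F : Type*} [Field F] [Fintype F] [DecidableEq F]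
variable {V : Type*} [AddCommGroup V] [Module F V] [Fintype V]

/-- Diagonalise the form. A change of basis multiplies the Gram determinant by a nonzero square, so
its quadratic character can be read off in any basis. -/
theorem sum_addChar_bilinForm {n : ℕ} (hF : ringChar F ≠ 2) {ψ : AddChar F ℂ} (hψ : ψ.IsPrimitive)
    {b : LinearMap.BilinForm F V} (hb : b.IsSymm) (hbn : b.Nondegenerate) (β : Module.Basis (Fin n) F V)
    {t : F} (ht : t ≠ 0) :
    ∑ x, ψ (t * b x x) = (quadraticChar F t : ℂ) ^ n *
      (quadraticChar F (LinearMap.BilinForm.toMatrix β b).det : ℂ) * gaussSum (quadCharC F) ψ ^ n := by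
  have hn : n = Module.finrank F V := by simp [Module.finrank_eq_card_basis β]
  subst hn
  have : Invertible (2 : F) := invertibleOfNonzero (Ring.two_ne_zero hF)
  obtain ⟨v, hv⟩ := LinearMap.BilinForm.exists_orthogonal_basis (LinearMap.isSymm_def.2 hb.eq)
  have hv0 : ∀ i, b (v i) (v i) ≠ 0 :=
    fun i => LinearMap.BilinForm.iIsOrtho.not_isOrtho_basis_self_of_nondegenerate hv hbn i
  rw [sum_addChar_orthogonal_basis hF hψ v hv hv0 ht]
  congr 3
  have hdiag : (LinearMap.BilinForm.toMatrix v b) = Matrix.diagonal fun i => b (v i) (v i) := by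
    ext i j
    rw [LinearMap.BilinForm.toMatrix_apply]
    by_cases hij : i = j
    · subst hij; simp
    · rw [Matrix.diagonal_apply_ne _ hij]
      exact hv hij
  have h1 := congrArg Matrix.det (LinearMap.BilinForm.toMatrix_mul_basis_toMatrix v β b)
  rw [Matrix.det_mul, Matrix.det_mul, Matrix.det_transpose, hdiag, Matrix.det_diagonal] at h1
  have hP : (v.toMatrix β).det ≠ 0 := by
    have := congrArg Matrix.det (v.toMatrix_mul_toMatrix_flip β)
    rw [Matrix.det_mul, Matrix.det_one] at this
    exact left_ne_zero_of_mul_eq_one this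
  rw [← h1, map_mul, map_mul]
  have := quadraticChar_sq_one hP
  rw [mul_right_comm, ← pow_two, this, one_mul]

omit [Fintype V] in
theorem excess_complex {ψ : AddChar F ℂ} (hψ : ψ.IsPrimitive) (b : LinearMap.BilinForm F V)
    (A : Submodule F V) [Fintype A] :
    (excess b A : ℂ) = ∑ t ∈ univ.erase (0 : F), ∑ x : A, ψ (t * b x x) := by
  have h := card_mul_ncard_zeros hψ b A
  rw [← Finset.add_sum_erase _ _ (mem_univ (0 : F))] at h
  simp only [zero_mul, AddChar.map_zero_eq_one, sum_const, card_univ, nsmul_eq_mul, mul_one] at h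
  have hA : (A : Set V).ncard = Fintype.card A := by
    rw [← Nat.card_coe_set_eq, ← Nat.card_eq_fintype_card]; rfl
  rw [excess, hA, Nat.card_eq_fintype_card]
  push_cast
  rw [h]; ring

theorem exists_isPrimitive_zmod (p : ℕ) [Fact p.Prime] : ∃ ψ : AddChar (ZMod p) ℂ, ψ.IsPrimitive :=
  ⟨ZMod.stdAddChar, ZMod.isPrimitive_stdAddChar p⟩

variable {p : ℕ} [Fact p.Prime] [Module (ZMod p) V]

/-- In odd dimension the exponential sum at t ≠ 0 depends on t only through the factor χ(t), and χ
sums to zero. -/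
theorem excess_top {k : ℕ} (hp2 : p ≠ 2)
    {b : LinearMap.BilinForm (ZMod p) V} (hb : b.IsSymm) (hbn : b.Nondegenerate)
    (β : Module.Basis (Fin (2 * k + 1)) (ZMod p) V) : excess b ⊤ = 0 := by
  classical
  have hF : ringChar (ZMod p) ≠ 2 := by rwa [ZMod.ringChar_zmod_n]
  obtain ⟨ψ, hψ⟩ := exists_isPrimitive_zmod p
  have h := excess_complex hψ b ⊤
  have h1 : ∀ t ∈ univ.erase (0 : ZMod p), ∑ x : (⊤ : Submodule (ZMod p) V), ψ (t * b x x) =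
      (quadraticChar (ZMod p) t : ℂ) * ((quadraticChar (ZMod p) (LinearMap.BilinForm.toMatrix β b).det : ℂ) *
        gaussSum (quadCharC (ZMod p)) ψ ^ (2 * k + 1)) := by
    intro t ht
    have ht0 : t ≠ 0 := (Finset.mem_erase.1 ht).1
    have e : ∑ x : (⊤ : Submodule (ZMod p) V), ψ (t * b x x) = ∑ x, ψ (t * b x x) :=
      Equiv.sum_comp (Submodule.topEquiv (R := ZMod p) (M := V)).toEquiv (fun x => ψ (t * b x x))
    rw [e, sum_addChar_bilinForm hF hψ hb hbn β ht0]
    have : (quadraticChar (ZMod p) t : ℂ) ^ 2 = 1 := by exact_mod_cast quadraticChar_sq_one ht0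
    rw [pow_add, pow_mul, this]; ring
  rw [Finset.sum_congr rfl h1, ← Finset.sum_mul] at h
  have h0 : ∑ t ∈ univ.erase (0 : ZMod p), (quadraticChar (ZMod p) t : ℂ) = 0 := by
    have h2 := quadraticChar_sum_zero hF
    rw [← Finset.add_sum_erase _ _ (mem_univ (0 : ZMod p)), quadraticChar_zero, zero_add] at h2
    exact_mod_cast h2
  rw [h0, zero_mul] at h
  exact_mod_cast h

/-- The orthogonal decomposition with respect to an anisotropic vector. -/
theorem sum_addChar_orthogonal (ψ : AddChar (ZMod p) ℂ)
    {b : LinearMap.BilinForm (ZMod p) V} (hb : b.IsSymm) {X : V} (hX : b X X ≠ 0) (t : ZMod p)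
    [Fintype (b.orthogonal (ZMod p ∙ X))] :
    ∑ x, ψ (t * b x x) = (∑ c, ψ (t * b X X * c ^ 2)) * ∑ y : b.orthogonal (ZMod p ∙ X), ψ (t * b y y) := by
  have hsymm : ∀ x y, b x y = b y x := fun x y => hb.eq x y
  have horth : ∀ y ∈ b.orthogonal (ZMod p ∙ X), b X y = 0 := fun y hy =>
    hy X (Submodule.mem_span_singleton_self X)
  rw [Finset.sum_mul_sum, ← Finset.sum_product', Finset.univ_product_univ]
  symm
  refine Fintype.sum_bijective (fun z : ZMod p × b.orthogonal (ZMod p ∙ X) => z.1 • X + (z.2 : V)) ⟨?_, ?_⟩ _ _ ?_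
  · rintro ⟨c, y, hy⟩ ⟨d, z, hz⟩ h
    have h : c • X + y = d • X + z := h
    have h1 := congrArg (b X) h
    simp only [map_add, map_smul, horth y hy, horth z hz, add_zero, smul_eq_mul] at h1
    have hcd := mul_right_cancel₀ hX h1
    subst hcd
    exact Prod.ext rfl (Subtype.ext (add_left_cancel h))
  · intro v
    refine ⟨(b X v / b X X, ⟨v - (b X v / b X X) • X, ?_⟩), by simp⟩
    intro y hy
    obtain ⟨c, rfl⟩ := Submodule.mem_span_singleton.1 hy
    simp [hX]
  · rintro ⟨c, y, hy⟩
    rw [← AddChar.map_add_eq_mul]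
    congr 1
    simp only [map_add, map_smul, LinearMap.add_apply, LinearMap.smul_apply, smul_eq_mul, horth y hy, hsymm y X]
    ring

/-- The exponential sum on X^⊥ is the sum on the whole space divided by the sum along the line of X,
so no determinant of the restricted form is needed. The factors χ(t) cancel, since X^⊥ has even
dimension 2k, and each of the p − 1 values t ≠ 0 contributes the same amount. -/
theorem excess_orthogonal {k : ℕ} (hp2 : p ≠ 2)
    {b : LinearMap.BilinForm (ZMod p) V} (hb : b.IsSymm) (hbn : b.Nondegenerate)
    (β : Module.Basis (Fin (2 * k + 1)) (ZMod p) V) {X : V} (hX : b X X ≠ 0) :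
    excess b (b.orthogonal (ZMod p ∙ X)) = (p - 1) * p ^ k *
      quadraticChar (ZMod p) ((-1) ^ k * (LinearMap.BilinForm.toMatrix β b).det * b X X) := by
  classical
  have hF : ringChar (ZMod p) ≠ 2 := by rwa [ZMod.ringChar_zmod_n]
  obtain ⟨ψ, hψ⟩ := exists_isPrimitive_zmod p
  set d := (LinearMap.BilinForm.toMatrix β b).det
  set G := gaussSum (quadCharC (ZMod p)) ψ with hG
  have hG2 : G ^ 2 = (quadraticChar (ZMod p) (-1) : ℂ) * p := by
    rw [hG, gaussSum_quadCharC_sq hF hψ, ZMod.card]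
  have hp0 : (p : ℂ) ≠ 0 := by exact_mod_cast (Fact.out : p.Prime).ne_zero
  have hsq : ∀ a : ZMod p, a ≠ 0 → (quadraticChar (ZMod p) a : ℂ) ^ 2 = 1 := by
    intro a ha
    exact_mod_cast quadraticChar_sq_one ha
  have hG0 : G ≠ 0 := by
    intro h
    rw [h, zero_pow two_ne_zero, eq_comm, mul_eq_zero] at hG2
    rcases hG2 with h' | h'
    · have := hsq (-1) (by simp)
      rw [h'] at this; norm_num at this
    · exact hp0 h'
  have h := excess_complex hψ b (b.orthogonal (ZMod p ∙ X))
  have h1 : ∀ t ∈ univ.erase (0 : ZMod p), ∑ x : b.orthogonal (ZMod p ∙ X), ψ (t * b x x) =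
      p ^ k * (quadraticChar (ZMod p) ((-1) ^ k * d * b X X) : ℂ) := by
    intro t ht
    have ht0 : t ≠ 0 := (Finset.mem_erase.1 ht).1
    have e1 := sum_addChar_bilinForm hF hψ hb hbn β ht0
    rw [sum_addChar_orthogonal ψ hb hX t, sum_addChar_mul_sq hF hψ (mul_ne_zero ht0 hX), ← hG, map_mul] at e1
    have e2 := hsq t ht0
    have e3 := hsq _ hX
    set x := (quadraticChar (ZMod p) t : ℂ)
    set y := (quadraticChar (ZMod p) (b X X) : ℂ)
    have hx0 : x ≠ 0 := by rintro h; rw [h] at e2; norm_num at e2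
    have hy0 : y ≠ 0 := by rintro h; rw [h] at e3; norm_num at e3
    have e4 : x ^ (2 * k + 1) = x := by rw [pow_succ, pow_mul, e2]; simp
    have e5 : G ^ (2 * k + 1) = ((quadraticChar (ZMod p) (-1) : ℂ)) ^ k * p ^ k * G := by
      rw [pow_succ, pow_mul, hG2, mul_pow]
    rw [e4, e5] at e1
    simp only [map_mul, map_pow]
    push_cast
    apply mul_left_cancel₀ (mul_ne_zero (mul_ne_zero hx0 hy0) hG0)
    push_cast at e1
    rw [e1]
    change _ = x * y * G * (p ^ k * (_ * y))
    linear_combination (-(x * (quadraticChar (ZMod p) d : ℂ) * G * p ^ k * (quadraticChar (ZMod p) (-1) : ℂ) ^ k)) * e3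
  rw [Finset.sum_congr rfl h1, Finset.sum_const, Finset.card_erase_of_mem (mem_univ _), Finset.card_univ,
    ZMod.card, nsmul_eq_mul, Nat.cast_sub (Fact.out : p.Prime).one_le] at h
  have h' : (excess b (b.orthogonal (ZMod p ∙ X)) : ℂ) = (((p - 1) * p ^ k *
      quadraticChar (ZMod p) ((-1) ^ k * d * b X X) : ℤ) : ℂ) := by
    rw [h]; push_cast; ring
  exact_mod_cast h'

end IntQuad

namespace IntQuad

/-! ### Counting in finite bilinear spaces over the prime field. -/

section FiniteSpaces

theorem ncard_eq_mul_of_fibers {α β : Type*} [Finite α] [Finite β] {S : Set (α × β)} {T : Set α} {n : ℕ}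
    (h1 : ∀ z ∈ S, z.1 ∈ T) (h2 : ∀ a ∈ T, {y | (a, y) ∈ S}.ncard = n) : S.ncard = T.ncard * n := by
  classical
  have := Fintype.ofFinite α
  have := Fintype.ofFinite β
  rw [Set.ncard_eq_toFinset_card' S, Set.ncard_eq_toFinset_card' T,
    Finset.card_eq_sum_card_fiberwise (f := Prod.fst) (t := T.toFinset), Finset.sum_const_nat (m := n)]
  · intro a ha
    rw [← h2 a (by simpa using ha), Set.ncard_eq_toFinset_card']
    refine Finset.card_bij' (fun z _ => z.2) (fun y _ => (a, y)) ?_ ?_ ?_ ?_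
    · rintro ⟨a', y⟩ hz
      simp only [Finset.mem_filter, Set.mem_toFinset] at hz
      obtain ⟨hz, rfl⟩ := hz
      simpa using hz
    · intro y hy
      simpa using hy
    · rintro ⟨a', y⟩ hz
      simp only [Finset.mem_filter, Set.mem_toFinset] at hz
      rw [hz.2]
    · intro y hy
      rfl
  · intro z hz
    simpa using h1 z (by simpa using hz)

variable {p : ℕ} [Fact p.Prime] {V : Type*} [AddCommGroup V] [Module (ZMod p) V] [Finite V]

theorem ncard_submodule (A : Submodule (ZMod p) V) : (A : Set V).ncard = p ^ Module.finrank (ZMod p) A := by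
  have := Module.natCard_eq_pow_finrank (K := ZMod p) (V := A)
  rw [Nat.card_zmod] at this
  rw [← this, ← Nat.card_coe_set_eq]
  rfl

theorem ncard_orthogonal {b : LinearMap.BilinForm (ZMod p) V} (hb : b.Nondegenerate) (A : Submodule (ZMod p) V) :
    (b.orthogonal A : Set V).ncard = p ^ (Module.finrank (ZMod p) V - Module.finrank (ZMod p) A) := by
  rw [ncard_submodule, LinearMap.BilinForm.finrank_orthogonal hb]

omit [Finite V] in
theorem mem_orthogonal_span {b : LinearMap.BilinForm (ZMod p) V} {s : Set V} {y : V} :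
    y ∈ b.orthogonal (Submodule.span (ZMod p) s) ↔ ∀ x ∈ s, b x y = 0 := by
  constructor
  · intro h x hx
    exact h x (Submodule.subset_span hx)
  · intro h x hx
    induction hx using Submodule.span_induction with
    | mem x hx => exact h x hx
    | zero => simp
    | add x y _ _ hx hy => rw [map_add, LinearMap.add_apply, hx, hy, add_zero]
    | smul c x _ hx => rw [map_smul, LinearMap.smul_apply, hx, smul_zero]

/-- The number of solutions of a system of independent affine equations. -/
theorem ncard_affine_system {b : LinearMap.BilinForm (ZMod p) V} (hb : b.Nondegenerate) {n : ℕ} {w : Fin n → V}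
    (hw : LinearIndependent (ZMod p) w) (c : Fin n → ZMod p) :
    {y | ∀ i, b (w i) y = c i}.ncard = p ^ (Module.finrank (ZMod p) V - n) := by
  set T : V →ₗ[ZMod p] (Fin n → ZMod p) := LinearMap.pi fun i => b (w i) with hT
  have hker : T.ker = b.orthogonal (Submodule.span (ZMod p) (Set.range w)) := by
    ext y
    rw [mem_orthogonal_span, LinearMap.mem_ker, funext_iff]
    simp [hT]
  have hn : Module.finrank (ZMod p) (Submodule.span (ZMod p) (Set.range w)) = n := by
    simpa using finrank_span_eq_card hw
  have hle : n ≤ Module.finrank (ZMod p) V := hn ▸ Submodule.finrank_le _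
  have hrange : T.range = ⊤ := by
    apply Submodule.eq_top_of_finrank_eq
    have h := T.finrank_range_add_finrank_ker
    rw [hker, LinearMap.BilinForm.finrank_orthogonal hb, hn] at h
    simp only [Module.finrank_fintype_fun_eq_card, Fintype.card_fin]
    omega
  obtain ⟨y₀, hy₀⟩ := LinearMap.range_eq_top.1 hrange c
  have himg : {y | ∀ i, b (w i) y = c i} = (fun y => y + y₀) '' (T.ker : Set V) := by
    ext y
    have hy₀' : ∀ i, b (w i) y₀ = c i := fun i => congrFun hy₀ i
    constructor
    · intro hy
      refine ⟨y - y₀, ?_, by simp⟩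
      rw [SetLike.mem_coe, LinearMap.mem_ker]
      ext i
      have hy : b (w i) y = c i := hy i
      simp [hT, hy, hy₀' i]
    · rintro ⟨z, hz, rfl⟩ i
      have : b (w i) z = 0 := congrFun (LinearMap.mem_ker.1 hz) i
      simp [this, hy₀' i]
  rw [himg, Set.ncard_image_of_injective _ (add_left_injective y₀), hker, ncard_orthogonal hb, hn]

end FiniteSpaces

/-! ### Reduction of integral columns modulo p and representatives modulo p². -/

section Reduction

variable {m : ℕ} (p : ℕ) [Fact p.Prime]

/-- Reduction of integral columns modulo `p`. -/
def red : (Fin m → ℤ) →+ (Fin m → ZMod p) := (Int.castAddHom (ZMod p)).compLeft (Fin m)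

/-- The lift of a column modulo `p` with entries in `[0, p)`. -/
def lift (v : Fin m → ZMod p) : Fin m → ℤ := fun i => ((v i).val : ℤ)

/-- A system of representatives of the columns modulo `p ^ 2`. -/
def rep (e : (Fin m → ZMod p) × (Fin m → ZMod p)) : Fin m → ℤ := lift p e.1 + (p : ℤ) • lift p e.2

variable {p}

theorem red_apply (x : Fin m → ℤ) (i : Fin m) : red p x i = (x i : ZMod p) := rfl

theorem red_smul (c : ℤ) (x : Fin m → ℤ) : red p (c • x) = (c : ZMod p) • red p x := by
  ext i; simp [red_apply]

@[simp] theorem red_p_smul (x : Fin m → ℤ) : red p ((p : ℤ) • x) = 0 := by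
  rw [red_smul]; simp

@[simp] theorem red_lift (v : Fin m → ZMod p) : red p (lift p v) = v := by
  ext i; simp [red_apply, lift]

@[simp] theorem red_rep (e : (Fin m → ZMod p) × (Fin m → ZMod p)) : red p (rep p e) = e.1 := by
  rw [rep, map_add, red_p_smul, add_zero, red_lift]

theorem red_eq_zero_iff {x : Fin m → ℤ} : red p x = 0 ↔ ∃ y, x = (p : ℤ) • y := by
  constructor
  · intro h
    have h1 : ∀ i, ∃ c, x i = p * c := fun i =>
      (ZMod.intCast_zmod_eq_zero_iff_dvd _ _).1 (congrFun h i)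
    choose y hy using h1
    exact ⟨y, funext hy⟩
  · rintro ⟨y, rfl⟩
    exact red_p_smul y

theorem red_eq_red_iff {x x' : Fin m → ℤ} : red p x = red p x' ↔ ∃ y, x = x' + (p : ℤ) • y := by
  rw [← sub_eq_zero, ← map_sub, red_eq_zero_iff]
  simp only [sub_eq_iff_eq_add']

theorem exists_rep (x : Fin m → ℤ) : ∃ e z, x = rep p e + (p : ℤ) • (p : ℤ) • z := by
  obtain ⟨y, hy⟩ := red_eq_red_iff.1 (red_lift (red p x)).symm
  obtain ⟨z, hz⟩ := red_eq_red_iff.1 (red_lift (red p y)).symm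
  refine ⟨(red p x, red p y), z, ?_⟩
  rw [rep, add_assoc, ← smul_add, ← hz, ← hy]

variable (p) in
/-- The image of a lattice modulo `p`. -/
def redSub (Λ : Submodule ℤ (Fin m → ℤ)) : Submodule (ZMod p) (Fin m → ZMod p) :=
  AddSubgroup.toZModSubmodule p (Λ.toAddSubgroup.map (red p))

theorem redSub_span (s : Set (Fin m → ℤ)) :
    redSub p (Submodule.span ℤ s) = Submodule.span (ZMod p) (red p '' s) := by
  apply le_antisymm
  · rintro v ⟨x, hx, rfl⟩
    change x ∈ Submodule.span ℤ s at hx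
    induction hx using Submodule.span_induction with
    | mem x hx => exact Submodule.subset_span ⟨x, hx, rfl⟩
    | zero => simp
    | add x y _ _ hx hy => rw [map_add]; exact add_mem hx hy
    | smul c x _ hx => change red p (c • x) ∈ _; rw [red_smul]; exact Submodule.smul_mem _ _ hx
  · rw [Submodule.span_le]
    rintro v ⟨x, hx, rfl⟩
    exact ⟨x, Submodule.subset_span hx, rfl⟩

end Reduction

/-! ### Good lattices and their enumeration by successive generators. -/

section Lattices

variable {m p : ℕ} [Fact p.Prime]

/-- `b` is the nondegenerate reduction modulo the odd prime `p` of the symmetric form `B`. -/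
structure IsReduction (B : LinearMap.BilinForm ℤ (Fin m → ℤ))
    (b : LinearMap.BilinForm (ZMod p) (Fin m → ZMod p)) : Prop where
  odd : p ≠ 2
  symmZ : ∀ x y, B x y = B y x
  symm : b.IsSymm
  nondeg : b.Nondegenerate
  compat : ∀ x y, b (red p x) (red p y) = (B x y : ZMod p)

/-- The lattices on which `p⁻² B` is integral and unimodular at `p`. -/
structure IsGood (p : ℕ) (B : LinearMap.BilinForm ℤ (Fin m → ℤ)) (Λ : Submodule ℤ (Fin m → ℤ)) : Prop where
  dvd : ∀ x ∈ Λ, ∀ y ∈ Λ, (p : ℤ) ^ 2 ∣ B x y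
  closed : ∀ y, (∀ x ∈ Λ, (p : ℤ) ∣ B x y) → (p : ℤ) • y ∈ Λ

variable {B : LinearMap.BilinForm ℤ (Fin m → ℤ)} {b : LinearMap.BilinForm (ZMod p) (Fin m → ZMod p)}

theorem p_sq_dvd_p_mul_iff {a : ℤ} : (p : ℤ) ^ 2 ∣ p * a ↔ (a : ZMod p) = 0 := by
  have hp : (p : ℤ) ≠ 0 := by exact_mod_cast (Fact.out : p.Prime).ne_zero
  rw [ZMod.intCast_zmod_eq_zero_iff_dvd, pow_two, mul_dvd_mul_iff_left hp]

theorem IsReduction.dvd_iff (h : IsReduction B b) {x y : Fin m → ℤ} : (p : ℤ) ∣ B x y ↔ b (red p x) (red p y) = 0 := by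
  rw [h.compat, ZMod.intCast_zmod_eq_zero_iff_dvd]

theorem IsReduction.mem_orthogonal_redSub (h : IsReduction B b) {Λ : Submodule ℤ (Fin m → ℤ)} {y : Fin m → ℤ} :
    red p y ∈ b.orthogonal (redSub p Λ) ↔ ∀ x ∈ Λ, (p : ℤ) ∣ B x y := by
  constructor
  · intro hy x hx
    exact h.dvd_iff.2 (hy _ ⟨x, hx, rfl⟩)
  · rintro hy _ ⟨x, hx, rfl⟩
    exact h.dvd_iff.1 (hy x hx)

/-- Integrality of p⁻²B on Λ gives one implication and unimodularity at p the other. The part of Λ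
inside pL is thus governed by the reduction of Λ alone. -/
theorem IsGood.p_smul_mem_iff (h : IsReduction B b) {Λ : Submodule ℤ (Fin m → ℤ)} (hΛ : IsGood p B Λ)
    {y : Fin m → ℤ} : (p : ℤ) • y ∈ Λ ↔ red p y ∈ b.orthogonal (redSub p Λ) := by
  rw [h.mem_orthogonal_redSub]
  refine ⟨fun hy x hx => ?_, hΛ.closed y⟩
  have := hΛ.dvd x hx _ hy
  rw [map_smul, smul_eq_mul, p_sq_dvd_p_mul_iff] at this
  exact (ZMod.intCast_zmod_eq_zero_iff_dvd _ _).1 this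

-- Pairings with py are divisible by p for trivial reasons. Membership in a good lattice is
-- therefore a condition modulo p², which leaves only finitely many good lattices.
omit [Fact p.Prime] in
theorem IsGood.p_sq_smul_mem {Λ : Submodule ℤ (Fin m → ℤ)} (hΛ : IsGood p B Λ)
    (y : Fin m → ℤ) : (p : ℤ) • (p : ℤ) • y ∈ Λ :=
  hΛ.closed _ fun x _ => by rw [map_smul]; exact dvd_mul_right _ _

theorem IsGood.totIso (h : IsReduction B b) {Λ : Submodule ℤ (Fin m → ℤ)} (hΛ : IsGood p B Λ) :
    TotIso b (redSub p Λ) := by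
  rintro _ ⟨x, hx, rfl⟩ _ ⟨y, hy, rfl⟩
  exact h.dvd_iff.1 ((dvd_pow_self _ two_ne_zero).trans (hΛ.dvd x hx y hy))

omit [Fact p.Prime] in
theorem IsGood.rep_mem_iff {Λ : Submodule ℤ (Fin m → ℤ)} (hΛ : IsGood p B Λ)
    {x z : Fin m → ℤ} {e : (Fin m → ZMod p) × (Fin m → ZMod p)} (hx : x = rep p e + (p : ℤ) • (p : ℤ) • z) :
    rep p e ∈ Λ ↔ x ∈ Λ := by
  rw [hx]
  exact (Submodule.add_mem_iff_left _ (hΛ.p_sq_smul_mem z)).symm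

theorem finite_isGood (p : ℕ) [Fact p.Prime] (B : LinearMap.BilinForm ℤ (Fin m → ℤ)) : {Λ | IsGood p B Λ}.Finite := by
  apply Set.Finite.of_finite_image (f := fun Λ => {e | rep p e ∈ Λ}) (Set.toFinite _)
  intro Λ hΛ Λ' hΛ' heq
  ext x
  obtain ⟨e, z, hx⟩ := exists_rep (p := p) x
  rw [← IsGood.rep_mem_iff hΛ hx, ← IsGood.rep_mem_iff hΛ' hx]
  exact Set.ext_iff.1 heq e

/-- Two lifts of v in Λ differ by an element of Λ ∩ pL, so the lifts modulo p² form a coset of U^⊥,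
where U is the reduction of Λ. -/
theorem IsGood.ncard_lifts (h : IsReduction B b) {Λ : Submodule ℤ (Fin m → ℤ)} (hΛ : IsGood p B Λ)
    {v : Fin m → ZMod p} (hv : v ∈ redSub p Λ) :
    {y | rep p (v, y) ∈ Λ}.ncard = p ^ (m - Module.finrank (ZMod p) (redSub p Λ)) := by
  obtain ⟨x, hx, rfl⟩ := hv
  obtain ⟨u, hu⟩ := red_eq_red_iff.1 (red_lift (red p x))
  have hiff : ∀ y, rep p (red p x, y) ∈ Λ ↔ y + red p u ∈ b.orthogonal (redSub p Λ) := by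
    intro y
    have e1 : rep p (red p x, y) = x + (p : ℤ) • (u + lift p y) := by
      rw [rep, hu, add_assoc, ← smul_add]
    rw [e1, Submodule.add_mem_iff_right _ hx, hΛ.p_smul_mem_iff h, map_add, red_lift, add_comm]
  have e2 : {y | rep p (red p x, y) ∈ Λ} =
      (fun y => y - red p u) '' (b.orthogonal (redSub p Λ) : Set (Fin m → ZMod p)) := by
    ext y
    rw [Set.mem_ofPred_eq, hiff]
    constructor
    · intro hy
      exact ⟨_, hy, by simp⟩
    · rintro ⟨z, hz, rfl⟩
      simpa using hz
  rw [e2, Set.ncard_image_of_injective _ sub_left_injective, ncard_orthogonal h.nondeg]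
  simp

theorem IsGood.ncard_rep_mem (h : IsReduction B b) {Λ : Submodule ℤ (Fin m → ℤ)} (hΛ : IsGood p B Λ)
    {U : Submodule (ZMod p) (Fin m → ZMod p)} (hU : U ≤ redSub p Λ) :
    {e | rep p e ∈ Λ ∧ e.1 ∉ U}.ncard =
      (p ^ Module.finrank (ZMod p) (redSub p Λ) - p ^ Module.finrank (ZMod p) U) *
        p ^ (m - Module.finrank (ZMod p) (redSub p Λ)) := by
  rw [ncard_eq_mul_of_fibers (T := (redSub p Λ : Set (Fin m → ZMod p)) \ U)
    (n := p ^ (m - Module.finrank (ZMod p) (redSub p Λ)))]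
  · congr 1
    rw [Set.ncard_sdiff hU, ncard_submodule, ncard_submodule]
  · rintro e ⟨he, heU⟩
    exact ⟨⟨_, he, red_rep e⟩, heU⟩
  · rintro v ⟨hv, hvU⟩
    rw [← hΛ.ncard_lifts h hv]
    congr 1
    ext y
    exact and_iff_left hvU

/-- The tuples that generate, modulo `p`, the reduction of a good lattice. -/
structure IsPartial (p : ℕ) [Fact p.Prime] (B : LinearMap.BilinForm ℤ (Fin m → ℤ)) {j : ℕ}
    (x : Fin j → (Fin m → ℤ)) : Prop where
  indep : LinearIndependent (ZMod p) (red p ∘ x)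
  dvd : ∀ i i', (p : ℤ) ^ 2 ∣ B (x i) (x i')

variable (p) in
/-- The span modulo `p` of a tuple. -/
def spanRed {j : ℕ} (x : Fin j → (Fin m → ℤ)) : Submodule (ZMod p) (Fin m → ZMod p) :=
  Submodule.span (ZMod p) (Set.range (red p ∘ x))

theorem IsPartial.finrank {j : ℕ} {x : Fin j → (Fin m → ℤ)} (hx : IsPartial p B x) :
    Module.finrank (ZMod p) (spanRed p x) = j :=
  (finrank_span_eq_card hx.indep).trans (Fintype.card_fin j)

theorem spanRed_le {j : ℕ} {x : Fin j → (Fin m → ℤ)} {Λ : Submodule ℤ (Fin m → ℤ)} (hx : ∀ i, x i ∈ Λ) :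
    spanRed p x ≤ redSub p Λ := by
  rw [spanRed, Submodule.span_le]
  rintro _ ⟨i, rfl⟩
  exact ⟨x i, hx i, rfl⟩

theorem spanRed_cons {j : ℕ} (x : Fin j → (Fin m → ℤ)) (x₀ : Fin m → ℤ) :
    spanRed p (Fin.cons x₀ x : Fin (j + 1) → (Fin m → ℤ)) = (ZMod p ∙ red p x₀) ⊔ spanRed p x := by
  rw [spanRed, Fin.comp_cons, Fin.range_cons, Submodule.span_insert, spanRed]

theorem IsPartial.cons_iff {j : ℕ} (hB : ∀ x y, B x y = B y x)
    {x : Fin j → (Fin m → ℤ)} (hx : IsPartial p B x) {x₀ : Fin m → ℤ} :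
    IsPartial p B (Fin.cons x₀ x : Fin (j + 1) → (Fin m → ℤ)) ↔
      red p x₀ ∉ spanRed p x ∧ (∀ i, (p : ℤ) ^ 2 ∣ B (x i) x₀) ∧ (p : ℤ) ^ 2 ∣ B x₀ x₀ := by
  constructor
  · rintro ⟨h1, h2⟩
    rw [Fin.comp_cons, linearIndependent_finCons] at h1
    exact ⟨h1.2, fun i => h2 i.succ 0, h2 0 0⟩
  · rintro ⟨h1, h2, h3⟩
    refine ⟨?_, ?_⟩
    · rw [Fin.comp_cons, linearIndependent_finCons]
      exact ⟨hx.indep, h1⟩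
    · intro i i'
      refine Fin.cases ?_ (fun i => ?_) i <;> refine Fin.cases ?_ (fun i' => ?_) i'
      · exact h3
      · simpa [hB x₀] using h2 i'
      · exact h2 i
      · exact hx.dvd i i'

theorem exists_affine_of_dvd {c d : ℤ} {e : ZMod p} (hc : (p : ℤ) ∣ c) (he : (d : ZMod p) = e) :
    (p : ℤ) ^ 2 ∣ c + p * d ↔ e = -((c / p : ℤ) : ZMod p) := by
  obtain ⟨c, rfl⟩ := hc
  have hp : (p : ℤ) ≠ 0 := by exact_mod_cast (Fact.out : p.Prime).ne_zero
  rw [Int.mul_ediv_cancel_left _ hp, ← mul_add, p_sq_dvd_p_mul_iff, Int.cast_add, he, eq_neg_iff_add_eq_zero, add_comm]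

/-- Write a lift of v as v + py. Divisibility by p² of its pairings with the x_i and with itself
amounts to j + 1 affine equations for y modulo p, whose linear parts b(x_i, y) and 2b(v, y) are
independent. -/
theorem ncard_partial_lifts (h : IsReduction B b) {j : ℕ} {x : Fin j → (Fin m → ℤ)} (hx : IsPartial p B x)
    {v : Fin m → ZMod p} (hv : v ∉ spanRed p x) (hiso : TotIso b ((ZMod p ∙ v) ⊔ spanRed p x)) :
    {y | IsPartial p B (Fin.cons (rep p (v, y)) x : Fin (j + 1) → (Fin m → ℤ))}.ncard = p ^ (m - (j + 1)) := by
  have hvm : v ∈ (ZMod p ∙ v) ⊔ spanRed p x := Submodule.mem_sup_left (Submodule.mem_span_singleton_self v)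
  have hxm : ∀ i, red p (x i) ∈ (ZMod p ∙ v) ⊔ spanRed p x := fun i =>
    Submodule.mem_sup_right (Submodule.subset_span ⟨i, rfl⟩)
  have h2 : (2 : ZMod p) ≠ 0 := Ring.two_ne_zero (by rw [ZMod.ringChar_zmod_n]; exact h.odd)
  -- The factor 2 comes from the cross term in B(v + py, v + py); it is harmless because p is odd.
  have hw : LinearIndependent (ZMod p) (Fin.cons ((2 : ZMod p) • v) (red p ∘ x) : Fin (j + 1) → (Fin m → ZMod p)) := by
    rw [linearIndependent_finCons]
    refine ⟨hx.indep, fun h' => hv ?_⟩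
    exact (Submodule.smul_mem_iff _ h2).1 h'
  have := ncard_affine_system h.nondeg hw
    (Fin.cons (-((B (lift p v) (lift p v) / p : ℤ) : ZMod p))
      fun i => -((B (x i) (lift p v) / p : ℤ) : ZMod p))
  rw [Module.finrank_fintype_fun_eq_card, Fintype.card_fin] at this
  rw [← this]
  congr 1
  ext y
  have e1 : ∀ i, B (x i) (rep p (v, y)) = B (x i) (lift p v) + p * B (x i) (lift p y) := by
    intro i
    rw [rep, map_add, map_smul, smul_eq_mul]
  have e2 : B (rep p (v, y)) (rep p (v, y)) =
      (B (lift p v) (lift p v) + p * (2 * B (lift p v) (lift p y))) + p ^ 2 * B (lift p y) (lift p y) := by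
    simp only [rep, map_add, map_smul, LinearMap.add_apply, LinearMap.smul_apply, smul_eq_mul,
      h.symmZ (lift p y) (lift p v)]
    ring
  have d1 : ∀ i, (p : ℤ) ∣ B (x i) (lift p v) := by
    intro i
    rw [h.dvd_iff, red_lift]
    exact hiso _ (hxm i) _ hvm
  have d2 : (p : ℤ) ∣ B (lift p v) (lift p v) := by
    rw [h.dvd_iff, red_lift]
    exact hiso _ hvm _ hvm
  have f1 : ∀ i, ((B (x i) (lift p y) : ℤ) : ZMod p) = b (red p (x i)) y := by
    intro i; rw [← h.compat, red_lift]
  have f2 : ((2 * B (lift p v) (lift p y) : ℤ) : ZMod p) = b ((2 : ZMod p) • v) y := by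
    rw [Int.cast_mul, ← h.compat, red_lift, red_lift]; simp
  simp only [Set.mem_ofPred_eq, hx.cons_iff h.symmZ, red_rep, e1, e2,
    (Int.dvd_add_left (dvd_mul_right ((p : ℤ) ^ 2) (B (lift p y) (lift p y)))), Fin.forall_fin_succ, Fin.cons_zero,
    Fin.cons_succ, exists_affine_of_dvd d2 f2, fun i => exists_affine_of_dvd (d1 i) (f1 i), Function.comp_apply]
  tauto

theorem ncard_extension (h : IsReduction B b) {P : Submodule (ZMod p) (Fin m → ZMod p) → Prop}
    (hP : ∀ U, P U → TotIso b U) {j : ℕ} {x : Fin j → (Fin m → ℤ)} (hx : IsPartial p B x) :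
    {e | IsPartial p B (Fin.cons (rep p e) x : Fin (j + 1) → (Fin m → ℤ)) ∧
        P ((ZMod p ∙ e.1) ⊔ spanRed p x)}.ncard =
      {v | v ∉ spanRed p x ∧ P ((ZMod p ∙ v) ⊔ spanRed p x)}.ncard * p ^ (m - (j + 1)) := by
  apply ncard_eq_mul_of_fibers
  · rintro e ⟨he, heP⟩
    rw [hx.cons_iff h.symmZ, red_rep] at he
    exact ⟨he.1, heP⟩
  · rintro v ⟨hv, hvP⟩
    rw [← ncard_partial_lifts h hx hv (hP _ hvP)]
    congr 1
    ext y
    exact and_iff_left hvP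

/-- The lattice `p · L_{U^⊥}`. -/
def pOrth (b : LinearMap.BilinForm (ZMod p) (Fin m → ZMod p)) (U : Submodule (ZMod p) (Fin m → ZMod p)) :
    Submodule ℤ (Fin m → ℤ) where
  carrier := {z | ∃ y, red p y ∈ b.orthogonal U ∧ z = (p : ℤ) • y}
  add_mem' := by
    rintro _ _ ⟨y, hy, rfl⟩ ⟨z, hz, rfl⟩
    exact ⟨y + z, by rw [map_add]; exact add_mem hy hz, by rw [smul_add]⟩
  zero_mem' := ⟨0, by simp, by simp⟩
  smul_mem' := by
    rintro c _ ⟨y, hy, rfl⟩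
    exact ⟨c • y, by rw [red_smul]; exact Submodule.smul_mem _ _ hy, by rw [smul_comm]⟩

theorem redSub_span_sup_pOrth {j : ℕ} (x : Fin j → (Fin m → ℤ)) (U : Submodule (ZMod p) (Fin m → ZMod p)) :
    redSub p (Submodule.span ℤ (Set.range x) ⊔ pOrth b U) = spanRed p x := by
  have h1 : redSub p (Submodule.span ℤ (Set.range x)) = spanRed p x := by
    rw [redSub_span, spanRed, Set.range_comp]
  apply le_antisymm
  · rintro _ ⟨z, hz, rfl⟩
    obtain ⟨u, hu, _, ⟨y, -, rfl⟩, rfl⟩ := Submodule.mem_sup.1 (show z ∈ _ ⊔ _ from hz)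
    rw [map_add, red_p_smul, add_zero, ← h1]
    exact ⟨u, hu, rfl⟩
  · rw [← h1]
    rintro _ ⟨z, hz, rfl⟩
    exact ⟨z, Submodule.mem_sup_left (show z ∈ Submodule.span ℤ _ from hz), rfl⟩

theorem IsPartial.dvd_span {j : ℕ} {x : Fin j → (Fin m → ℤ)} (hx : IsPartial p B x) {u u' : Fin m → ℤ}
    (hu : u ∈ Submodule.span ℤ (Set.range x)) (hu' : u' ∈ Submodule.span ℤ (Set.range x)) :
    (p : ℤ) ^ 2 ∣ B u u' := by
  obtain ⟨c, rfl⟩ := (Submodule.mem_span_range_iff_exists_fun ℤ).1 hu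
  obtain ⟨d, rfl⟩ := (Submodule.mem_span_range_iff_exists_fun ℤ).1 hu'
  simp only [map_sum, LinearMap.sum_apply, map_smul, LinearMap.smul_apply, smul_eq_mul]
  exact Finset.dvd_sum fun i _ => Dvd.dvd.mul_left (Finset.dvd_sum fun i' _ => Dvd.dvd.mul_left (hx.dvd _ _) _) _

/-- Mixed pairings of the span with p times the preimage of U^⊥ gain one p from the factor and one
from orthogonality. For the second property, a y pairing into pℤ with the lattice reduces into U^⊥,
so py was included from the start. -/
theorem IsPartial.isGood (h : IsReduction B b) {j : ℕ} {x : Fin j → (Fin m → ℤ)} (hx : IsPartial p B x) :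
    IsGood p B (Submodule.span ℤ (Set.range x) ⊔ pOrth b (spanRed p x)) := by
  have hmem : ∀ u ∈ Submodule.span ℤ (Set.range x), red p u ∈ spanRed p x := by
    intro u hu
    rw [← redSub_span_sup_pOrth (b := b) x (spanRed p x)]
    exact ⟨u, Submodule.mem_sup_left hu, rfl⟩
  refine ⟨?_, ?_⟩
  · intro z hz z' hz'
    obtain ⟨u, hu, _, ⟨y, hy, rfl⟩, rfl⟩ := Submodule.mem_sup.1 hz
    obtain ⟨u', hu', _, ⟨y', hy', rfl⟩, rfl⟩ := Submodule.mem_sup.1 hz'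
    obtain ⟨c1, h1⟩ := hx.dvd_span hu hu'
    obtain ⟨c2, h2⟩ := h.dvd_iff.2 (hy' _ (hmem u hu))
    obtain ⟨c3, h3⟩ := h.dvd_iff.2 (hy _ (hmem u' hu'))
    refine ⟨c1 + c2 + c3 + B y y', ?_⟩
    simp only [map_add, map_smul, LinearMap.add_apply, LinearMap.smul_apply, smul_eq_mul, h1, h2, h.symmZ y u', h3]
    ring
  · intro y hy
    refine Submodule.mem_sup_right ⟨y, ?_, rfl⟩
    rw [← redSub_span_sup_pOrth (b := b) x (spanRed p x)]
    exact h.mem_orthogonal_redSub.2 hy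

/-- Modulo p every element of Λ is a combination of the x_i; the difference lies in Λ ∩ pL, which
the reduction determines. -/
theorem IsGood.eq_span_sup_pOrth (h : IsReduction B b) {Λ : Submodule ℤ (Fin m → ℤ)} (hΛ : IsGood p B Λ)
    {j : ℕ} {x : Fin j → (Fin m → ℤ)} (hx : ∀ i, x i ∈ Λ) (hr : redSub p Λ = spanRed p x) :
    Λ = Submodule.span ℤ (Set.range x) ⊔ pOrth b (spanRed p x) := by
  have hle : Submodule.span ℤ (Set.range x) ≤ Λ := by
    rw [Submodule.span_le]
    rintro _ ⟨i, rfl⟩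
    exact hx i
  apply le_antisymm
  · intro z hz
    have hz' : red p z ∈ redSub p (Submodule.span ℤ (Set.range x) ⊔ pOrth b (spanRed p x)) := by
      rw [redSub_span_sup_pOrth, ← hr]
      exact ⟨z, hz, rfl⟩
    obtain ⟨w, hw, hwz⟩ := hz'
    obtain ⟨u, hu, _, ⟨y, -, rfl⟩, rfl⟩ := Submodule.mem_sup.1 (show w ∈ _ ⊔ _ from hw)
    rw [map_add, red_p_smul, add_zero] at hwz
    obtain ⟨y', rfl⟩ := red_eq_red_iff.1 hwz.symm
    refine add_mem (Submodule.mem_sup_left hu) (Submodule.mem_sup_right ⟨y', ?_, rfl⟩)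
    rw [← hr, ← hΛ.p_smul_mem_iff h]
    exact (Submodule.add_mem_iff_right _ (hle hu)).1 hz
  · refine sup_le hle ?_
    rintro _ ⟨y, hy, rfl⟩
    rw [← hr] at hy
    exact (hΛ.p_smul_mem_iff h).2 hy

/-- The good lattices through a given tuple whose reduction has dimension `a` and the property `P`. -/
def goodThrough (p : ℕ) [Fact p.Prime] (B : LinearMap.BilinForm ℤ (Fin m → ℤ))
    (P : Submodule (ZMod p) (Fin m → ZMod p) → Prop) (a : ℕ) {j : ℕ} (x : Fin j → (Fin m → ℤ)) :
    Set (Submodule ℤ (Fin m → ℤ)) :=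
  {Λ | IsGood p B Λ ∧ P (redSub p Λ) ∧ Module.finrank (ZMod p) (redSub p Λ) = a ∧ ∀ i, x i ∈ Λ}

theorem finite_goodThrough {P : Submodule (ZMod p) (Fin m → ZMod p) → Prop} {a j : ℕ} (x : Fin j → (Fin m → ℤ)) :
    (goodThrough p B P a x).Finite := (finite_isGood p B).subset fun _ h => h.1

theorem ncard_goodThrough_self (h : IsReduction B b) {P : Submodule (ZMod p) (Fin m → ZMod p) → Prop}
    {a : ℕ} {x : Fin a → (Fin m → ℤ)} (hx : IsPartial p B x) (hPx : P (spanRed p x)) :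
    (goodThrough p B P a x).ncard = 1 := by
  rw [Set.ncard_eq_one]
  refine ⟨Submodule.span ℤ (Set.range x) ⊔ pOrth b (spanRed p x), Set.eq_singleton_iff_unique_mem.2 ⟨?_, ?_⟩⟩
  · refine ⟨hx.isGood h, ?_, ?_, fun i => Submodule.mem_sup_left (Submodule.subset_span ⟨i, rfl⟩)⟩
    · rwa [redSub_span_sup_pOrth]
    · rw [redSub_span_sup_pOrth, hx.finrank]
  · rintro Λ ⟨hΛ, -, hr, hxΛ⟩
    refine hΛ.eq_span_sup_pOrth h hxΛ (Submodule.eq_of_le_of_finrank_eq (spanRed_le hxΛ) ?_).symm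
    rw [hx.finrank, hr]

/-- Double count the pairs (Λ, e) with e ∈ Λ a residue modulo p² whose reduction lies outside the
span of the tuple. Each Λ offers (p^a − p^j) reductions with p^{m−a} lifts each, and each admissible
e lies in N lattices. -/
theorem ncard_goodThrough_step (h : IsReduction B b) {P : Submodule (ZMod p) (Fin m → ZMod p) → Prop}
    (hP : ∀ U, P U → TotIso b U) (hmono : ∀ U W, U ≤ W → P W → P U) {a j N : ℕ}
    {x : Fin j → (Fin m → ℤ)} (hx : IsPartial p B x)
    (hN : ∀ x₀, IsPartial p B (Fin.cons x₀ x : Fin (j + 1) → (Fin m → ℤ)) →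
      P (spanRed p (Fin.cons x₀ x : Fin (j + 1) → (Fin m → ℤ))) →
      (goodThrough p B P a (Fin.cons x₀ x : Fin (j + 1) → (Fin m → ℤ))).ncard = N) :
    (goodThrough p B P a x).ncard * ((p ^ a - p ^ j) * p ^ (m - a)) =
      ({v | v ∉ spanRed p x ∧ P ((ZMod p ∙ v) ⊔ spanRed p x)}.ncard * p ^ (m - (j + 1))) * N := by
  classical
  rw [← ncard_extension h hP hx]
  have hfin := finite_goodThrough (B := B) (P := P) (a := a) x
  set E : Set ((Fin m → ZMod p) × (Fin m → ZMod p)) :=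
    {e | IsPartial p B (Fin.cons (rep p e) x : Fin (j + 1) → (Fin m → ℤ)) ∧ P ((ZMod p ∙ e.1) ⊔ spanRed p x)} with hE
  have hEfin : E.Finite := Set.toFinite _
  rw [Set.ncard_eq_toFinset_card _ hfin, Set.ncard_eq_toFinset_card _ hEfin]
  refine Finset.card_mul_eq_card_mul (fun Λ e => rep p e ∈ Λ) ?_ ?_
  · intro Λ hΛ
    rw [Set.Finite.mem_toFinset] at hΛ
    obtain ⟨hg, hPΛ, hr, hxΛ⟩ := hΛ
    have h1 := hg.ncard_rep_mem h (spanRed_le hxΛ)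
    rw [hr, hx.finrank] at h1
    rw [← h1, ← Set.ncard_coe_finset]
    congr 1
    ext e
    simp only [Finset.bipartiteAbove, Finset.coe_filter, Set.Finite.mem_toFinset, Set.mem_ofPred_eq, hE,
      hx.cons_iff h.symmZ, red_rep]
    constructor
    · rintro ⟨⟨⟨h1, -⟩, -⟩, h2⟩
      exact ⟨h2, h1⟩
    · rintro ⟨he, heU⟩
      refine ⟨⟨⟨heU, fun i => hg.dvd _ (hxΛ i) _ he, hg.dvd _ he _ he⟩, hmono _ _ ?_ hPΛ⟩, he⟩
      refine sup_le ?_ (spanRed_le hxΛ)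
      rw [Submodule.span_singleton_le_iff_mem]
      exact ⟨_, he, red_rep e⟩
  · intro e he
    rw [Set.Finite.mem_toFinset] at he
    rw [← hN (rep p e) he.1 (by rw [spanRed_cons, red_rep]; exact he.2), ← Set.ncard_coe_finset]
    congr 1
    ext Λ
    simp only [Finset.bipartiteBelow, Finset.coe_filter, Set.Finite.mem_toFinset, Set.mem_ofPred_eq, goodThrough,
      Fin.forall_fin_succ, Fin.cons_zero, Fin.cons_succ]
    tauto

/-- Iterate the double counting from length j up to length a, where the lattice is unique. The
function f records that the number of admissible next directions depends only on the dimension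
already reached. -/
theorem ncard_goodThrough (h : IsReduction B b) {P : Submodule (ZMod p) (Fin m → ZMod p) → Prop}
    (hP : ∀ U, P U → TotIso b U) (hmono : ∀ U W, U ≤ W → P W → P U) {a : ℕ} (ham : a ≤ m) {f : ℕ → ℚ}
    (hf : ∀ U, P U → Module.finrank (ZMod p) U < a →
      ({v | v ∉ U ∧ P ((ZMod p ∙ v) ⊔ U)}.ncard : ℚ) = f (Module.finrank (ZMod p) U))
    {j : ℕ} (hj : j ≤ a) {x : Fin j → (Fin m → ℤ)} (hx : IsPartial p B x) (hPx : P (spanRed p x)) :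
    ((goodThrough p B P a x).ncard : ℚ) =
      ∏ i ∈ Finset.Ico j a, f i * (p : ℚ) ^ (a - 1 - i) / ((p : ℚ) ^ a - (p : ℚ) ^ i) := by
  induction hd : a - j generalizing j with
  | zero =>
    obtain rfl : j = a := by omega
    simp [ncard_goodThrough_self h hx hPx]
  | succ d ih =>
    have hja : j < a := by omega
    have ih := fun {x'} => ih (j := j + 1) hja (x := x') (hd := by omega)
    have hp1 : 1 < p := (Fact.out : p.Prime).one_lt
    have hp0 : (p : ℚ) ≠ 0 := by positivity
    set N : ℚ := ∏ i ∈ Finset.Ico (j + 1) a, f i * (p : ℚ) ^ (a - 1 - i) / ((p : ℚ) ^ a - (p : ℚ) ^ i) with hN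
    rw [Finset.prod_eq_prod_Ico_succ_bot hja, ← hN]
    have hlt : (p : ℚ) ^ j < (p : ℚ) ^ a := pow_lt_pow_right₀ (by exact_mod_cast hp1) hja
    have hfx := hf _ hPx (by rwa [hx.finrank])
    rw [hx.finrank] at hfx
    have main : ∀ N' : ℕ, ((N' : ℚ) = N ∨ f j = 0) → (goodThrough p B P a x).ncard * ((p ^ a - p ^ j) * p ^ (m - a)) =
      ({v | v ∉ spanRed p x ∧ P ((ZMod p ∙ v) ⊔ spanRed p x)}.ncard * p ^ (m - (j + 1))) * N' →
      ((goodThrough p B P a x).ncard : ℚ) = f j * (p : ℚ) ^ (a - 1 - j) / ((p : ℚ) ^ a - (p : ℚ) ^ j) * N := by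
      intro N' hN' hs
      have hs' := congrArg (Nat.cast (R := ℚ)) hs
      push_cast [Nat.cast_sub (Nat.pow_le_pow_right hp1.le hja.le)] at hs'
      -- There are p^{m−j−1} lifts of a generator to a partial tuple against p^{m−a} lifts inside Λ;
      -- their quotient is the factor p^{a−1−j}.
      rw [hfx, show m - (j + 1) = (a - 1 - j) + (m - a) by omega, pow_add] at hs'
      rw [div_mul_eq_mul_div, eq_div_iff (sub_ne_zero.2 hlt.ne')]
      apply mul_right_cancel₀ (pow_ne_zero (m - a) hp0)
      rcases hN' with h' | h'
      · rw [h'] at hs'; linear_combination hs'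
      · rw [h'] at hs' ⊢; linear_combination hs'
    by_cases hex : ∃ x₀, IsPartial p B (Fin.cons x₀ x : Fin (j + 1) → (Fin m → ℤ)) ∧
      P (spanRed p (Fin.cons x₀ x : Fin (j + 1) → (Fin m → ℤ)))
    · obtain ⟨x₀, h1, h2⟩ := hex
      refine main _ (Or.inl (ih h1 h2)) (ncard_goodThrough_step h hP hmono hx fun x₁ h3 h4 => ?_)
      exact_mod_cast (ih h3 h4).trans (ih h1 h2).symm
    -- With no admissible extension the double count holds vacuously both for N = 0 and for N = 1.
    -- Comparing the two shows that there are no admissible directions, so f j = 0 and the remaining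
    -- factors do not matter.
    · have hs := ncard_goodThrough_step (a := a) (N := 0) h hP hmono hx fun x₁ h3 h4 => absurd ⟨x₁, h3, h4⟩ hex
      refine main 0 ?_ hs
      right
      have hs2 := ncard_goodThrough_step (a := a) (N := 1) h hP hmono hx fun x₁ h3 h4 => absurd ⟨x₁, h3, h4⟩ hex
      rw [hs, mul_zero, mul_one, eq_comm, mul_eq_zero] at hs2
      rw [← hfx]
      exact_mod_cast hs2.resolve_right (pow_ne_zero _ (by omega))

end Lattices

end IntQuad

namespace IntQuad

/-! ### Vectors enlarging a totally isotropic subspace. -/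

section Spaces

variable {p : ℕ} [Fact p.Prime] {V : Type*} [AddCommGroup V] [Module (ZMod p) V] [Finite V]
  {b : LinearMap.BilinForm (ZMod p) V}

omit [Finite V] in
theorem TotIso.mono {U W : Submodule (ZMod p) V} (h : U ≤ W) (hW : TotIso b W) : TotIso b U :=
  fun x hx y hy => hW x (h hx) y (h hy)

omit [Finite V] in
theorem TotIso.le_orthogonal {U : Submodule (ZMod p) V} (hU : TotIso b U) : U ≤ b.orthogonal U :=
  fun x hx y hy => hU y hy x hx

omit [Finite V] in
theorem totIso_sup_iff (hb : b.IsSymm) {U : Submodule (ZMod p) V} (hU : TotIso b U) {v : V} :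
    TotIso b ((ZMod p ∙ v) ⊔ U) ↔ v ∈ zeros b (b.orthogonal U) := by
  have hsymm : ∀ x y, b x y = b y x := fun x y => hb.eq x y
  constructor
  · intro h
    have hv : v ∈ (ZMod p ∙ v) ⊔ U := Submodule.mem_sup_left (Submodule.mem_span_singleton_self v)
    exact ⟨fun y hy => h y (Submodule.mem_sup_right hy) v hv, h v hv v hv⟩
  · rintro ⟨h1, h2⟩ x hx y hy
    have h1 : ∀ u ∈ U, b u v = 0 := h1
    obtain ⟨_, hc, u, hu, rfl⟩ := Submodule.mem_sup.1 hx
    obtain ⟨_, hd, w, hw, rfl⟩ := Submodule.mem_sup.1 hy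
    obtain ⟨c, rfl⟩ := Submodule.mem_span_singleton.1 hc
    obtain ⟨d, rfl⟩ := Submodule.mem_span_singleton.1 hd
    simp [h2, h1 u hu, hsymm v w, h1 w hw, hU u hu w hw]

omit [Finite V] in
theorem le_orthogonal_span_singleton (hb : b.IsSymm) {U : Submodule (ZMod p) V} {X : V} :
    U ≤ b.orthogonal (ZMod p ∙ X) ↔ X ∈ b.orthogonal U := by
  have hsymm : ∀ x y, b x y = b y x := fun x y => hb.eq x y
  constructor
  · intro h u hu
    exact (hsymm u X).trans (h hu X (Submodule.mem_span_singleton_self X))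
  · intro h u hu y hy
    obtain ⟨c, rfl⟩ := Submodule.mem_span_singleton.1 hy
    have : b u X = 0 := h u hu
    simp [hsymm X u, this]

theorem TotIso.finrank_le (hbn : b.Nondegenerate) {k : ℕ} (hV : Module.finrank (ZMod p) V = 2 * k + 1)
    {U : Submodule (ZMod p) V} (hU : TotIso b U) : Module.finrank (ZMod p) U ≤ k := by
  have h1 := Submodule.finrank_mono hU.le_orthogonal
  rw [LinearMap.BilinForm.finrank_orthogonal hbn, hV] at h1
  omega

theorem finrank_span_singleton_sup {U : Submodule (ZMod p) V} {X : V} (hX : X ∉ U) :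
    Module.finrank (ZMod p) ((ZMod p ∙ X) ⊔ U : Submodule (ZMod p) V) = Module.finrank (ZMod p) U + 1 := by
  have h1 := Submodule.finrank_sup_add_finrank_inf_eq (ZMod p ∙ X) U
  have hX0 : X ≠ 0 := by rintro rfl; exact hX U.zero_mem
  have h2 : (ZMod p ∙ X) ⊓ U = ⊥ := by
    rw [eq_bot_iff]
    rintro y ⟨hy, hyU⟩
    obtain ⟨c, rfl⟩ := Submodule.mem_span_singleton.1 hy
    by_cases hc : c = 0
    · simp [hc]
    · exact absurd ((Submodule.smul_mem_iff _ hc).1 hyU) hX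
  rw [h2, finrank_bot, finrank_span_singleton hX0] at h1
  omega

theorem p_mul_ncard_zeros (A : Submodule (ZMod p) V) :
    (p : ℚ) * (zeros b A).ncard = excess b A + (p : ℚ) ^ Module.finrank (ZMod p) A := by
  rw [excess, ncard_submodule, Nat.card_zmod]
  push_cast; ring

theorem ncard_zeros_sdiff {U : Submodule (ZMod p) V} (hU : TotIso b U) {A : Submodule (ZMod p) V} (hA : U ≤ A) :
    ((zeros b A \ (U : Set V)).ncard : ℚ) = (zeros b A).ncard - (p : ℚ) ^ Module.finrank (ZMod p) U := by
  have hs : (U : Set V) ⊆ zeros b A := fun x hx => ⟨hA hx, hU x hx x hx⟩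
  rw [Set.ncard_sdiff hs, Nat.cast_sub (Set.ncard_le_ncard hs (Set.toFinite _)), ncard_submodule]
  push_cast; rfl

variable {k : ℕ}

/-- U^⊥ has the same excess as the whole space, namely 0, so exactly one p-th of its vectors are
zeros; those in U are then discarded. -/
theorem ncard_zeros_orthogonal (hp2 : p ≠ 2) (hb : b.IsSymm) (hbn : b.Nondegenerate)
    (β : Module.Basis (Fin (2 * k + 1)) (ZMod p) V) {U : Submodule (ZMod p) V} (hU : TotIso b U) :
    ((zeros b (b.orthogonal U) \ (U : Set V)).ncard : ℚ) =
      (p : ℚ) ^ (2 * k - Module.finrank (ZMod p) U) - (p : ℚ) ^ Module.finrank (ZMod p) U := by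
  have := Fintype.ofFinite V
  have hV : Module.finrank (ZMod p) V = 2 * k + 1 := by simp [Module.finrank_eq_card_basis β]
  have hle := hU.finrank_le hbn hV
  have hp0 : (p : ℚ) ≠ 0 := by exact_mod_cast (Fact.out : p.Prime).ne_zero
  have h2 : (2 : ZMod p) ≠ 0 := Ring.two_ne_zero (by rwa [ZMod.ringChar_zmod_n])
  have h1 := p_mul_ncard_zeros (b := b) (b.orthogonal U)
  have h3 := excess_inf_orthogonal hb h2 hU (A := ⊤) le_top
  rw [top_inf_eq, excess_top hp2 hb hbn β] at h3
  rw [h3, LinearMap.BilinForm.finrank_orthogonal hbn, hV, Int.cast_zero, zero_add,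
    show 2 * k + 1 - Module.finrank (ZMod p) U = (2 * k - Module.finrank (ZMod p) U) + 1 by omega, pow_succ'] at h1
  rw [ncard_zeros_sdiff hU hU.le_orthogonal, mul_left_cancel₀ hp0 h1]

/-- Cutting X^⊥ by U^⊥ preserves the excess, so the character term of X^⊥ appears unchanged for
every U. -/
theorem ncard_zeros_orthogonal_anisotropic (hp2 : p ≠ 2) (hb : b.IsSymm) (hbn : b.Nondegenerate)
    (β : Module.Basis (Fin (2 * k + 1)) (ZMod p) V) {X : V} (hX : b X X ≠ 0)
    {U : Submodule (ZMod p) V} (hU : TotIso b U) (hUX : U ≤ b.orthogonal (ZMod p ∙ X))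
    (hUk : Module.finrank (ZMod p) U < k) :
    ((zeros b (b.orthogonal (ZMod p ∙ X) ⊓ b.orthogonal U) \ (U : Set V)).ncard : ℚ) =
      (p : ℚ) ^ (2 * k - 1 - Module.finrank (ZMod p) U) - (p : ℚ) ^ Module.finrank (ZMod p) U +
      quadraticChar (ZMod p) ((-1) ^ k * (LinearMap.BilinForm.toMatrix β b).det * b X X) *
        ((p : ℚ) ^ k - (p : ℚ) ^ (k - 1)) := by
  have := Fintype.ofFinite V
  have hV : Module.finrank (ZMod p) V = 2 * k + 1 := by simp [Module.finrank_eq_card_basis β]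
  have hp0 : (p : ℚ) ≠ 0 := by exact_mod_cast (Fact.out : p.Prime).ne_zero
  have h2 : (2 : ZMod p) ≠ 0 := Ring.two_ne_zero (by rwa [ZMod.ringChar_zmod_n])
  have hXU : X ∉ U := fun h => hX (hUX h X (Submodule.mem_span_singleton_self X))
  have h1 := p_mul_ncard_zeros (b := b) (b.orthogonal (ZMod p ∙ X) ⊓ b.orthogonal U)
  rw [excess_inf_orthogonal hb h2 hU hUX, excess_orthogonal hp2 hb hbn β hX, ← orthogonal_sup,
    LinearMap.BilinForm.finrank_orthogonal hbn, hV, finrank_span_singleton_sup hXU,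
    show 2 * k + 1 - (Module.finrank (ZMod p) U + 1) = (2 * k - 1 - Module.finrank (ZMod p) U) + 1 by omega, pow_succ',
    orthogonal_sup] at h1
  rw [ncard_zeros_sdiff hU (le_inf hUX hU.le_orthogonal)]
  apply mul_left_cancel₀ hp0
  rw [mul_sub, h1]
  obtain ⟨k, rfl⟩ : ∃ l, k = l + 1 := ⟨k - 1, by omega⟩
  push_cast
  ring

end Spaces

/-! ### Numbers of good lattices with prescribed reduction type. -/

section Counts

variable {k p : ℕ} [Fact p.Prime] {B : LinearMap.BilinForm ℤ (Fin (2 * k + 1) → ℤ)}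
  {b : LinearMap.BilinForm (ZMod p) (Fin (2 * k + 1) → ZMod p)}

theorem isPartial_nil (p : ℕ) [Fact p.Prime] (B : LinearMap.BilinForm ℤ (Fin (2 * k + 1) → ℤ)) :
    IsPartial p B (Fin.elim0 : Fin 0 → (Fin (2 * k + 1) → ℤ)) :=
  ⟨linearIndependent_empty_type, fun i => i.elim0⟩

theorem spanRed_nil : spanRed p (Fin.elim0 : Fin 0 → (Fin (2 * k + 1) → ℤ)) = ⊥ := by
  rw [spanRed, Set.range_eq_empty, Submodule.span_empty]

theorem totIso_bot : TotIso b ⊥ := by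
  intro x hx y hy
  rw [(Submodule.mem_bot _).1 hx]; simp

theorem ncard_goodThrough_totIso (h : IsReduction B b) {a j : ℕ} (ha : a ≤ k) (hj : j ≤ a)
    {x : Fin j → (Fin (2 * k + 1) → ℤ)} (hx : IsPartial p B x) (hxi : TotIso b (spanRed p x)) :
    ((goodThrough p B (TotIso b) a x).ncard : ℚ) =
      ∏ i ∈ Finset.Ico j a, ((p : ℚ) ^ (2 * k - i) - (p : ℚ) ^ i) * (p : ℚ) ^ (a - 1 - i) / ((p : ℚ) ^ a - (p : ℚ) ^ i) := by
  refine ncard_goodThrough (f := fun i => (p : ℚ) ^ (2 * k - i) - (p : ℚ) ^ i) h (fun _ h => h)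
    (fun _ _ => TotIso.mono) (by omega) ?_ hj hx hxi
  intro U hU hUa
  rw [← ncard_zeros_orthogonal h.odd h.symm h.nondeg (Pi.basisFun _ _) hU]
  congr 2
  ext v
  simp only [Set.mem_ofPred_eq, totIso_sup_iff h.symm hU, Set.mem_sdiff, SetLike.mem_coe]
  tauto

theorem ncard_goodThrough_anisotropic (h : IsReduction B b) {a : ℕ} (ha : a ≤ k)
    {X : Fin (2 * k + 1) → ZMod p} (hX : b X X ≠ 0) :
    ((goodThrough p B (fun U => TotIso b U ∧ U ≤ b.orthogonal (ZMod p ∙ X)) a Fin.elim0).ncard : ℚ) =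
      ∏ i ∈ Finset.Ico 0 a, ((p : ℚ) ^ (2 * k - 1 - i) - (p : ℚ) ^ i +
        quadraticChar (ZMod p) ((-1) ^ k * (LinearMap.BilinForm.toMatrix (Pi.basisFun _ _) b).det * b X X) *
        ((p : ℚ) ^ k - (p : ℚ) ^ (k - 1))) * (p : ℚ) ^ (a - 1 - i) / ((p : ℚ) ^ a - (p : ℚ) ^ i) := by
  refine ncard_goodThrough (f := fun i => (p : ℚ) ^ (2 * k - 1 - i) - (p : ℚ) ^ i +
        quadraticChar (ZMod p) ((-1) ^ k * (LinearMap.BilinForm.toMatrix (Pi.basisFun _ _) b).det * b X X) *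
        ((p : ℚ) ^ k - (p : ℚ) ^ (k - 1))) h (fun _ h => h.1)
    (fun _ _ hle hW => ⟨hW.1.mono hle, hle.trans hW.2⟩) (by omega) ?_ (Nat.zero_le a) (isPartial_nil p B) ?_
  · rintro U ⟨hU, hUX⟩ hUa
    rw [← ncard_zeros_orthogonal_anisotropic h.odd h.symm h.nondeg (Pi.basisFun _ _) hX hU hUX (by omega)]
    congr 2
    ext v
    simp only [Set.mem_ofPred_eq, totIso_sup_iff h.symm hU, Set.mem_sdiff, SetLike.mem_coe, zeros, sup_le_iff,
      Submodule.span_singleton_le_iff_mem, Submodule.mem_inf]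
    tauto
  · rw [spanRed_nil]
    exact ⟨totIso_bot, bot_le⟩

/-- By the exchange property, v enlarges U without bringing X into the span exactly when v lies
outside U + X. The admissible v are thus the isotropic vectors of (U + X)^⊥ outside U + X, which
explains the shift of i to i + 1. -/
theorem ncard_goodThrough_isotropic (h : IsReduction B b) {a : ℕ} (ha : a ≤ k)
    {X : Fin (2 * k + 1) → ZMod p} (hX : b X X = 0) (hX0 : X ≠ 0) :
    ((goodThrough p B (fun U => (TotIso b U ∧ U ≤ b.orthogonal (ZMod p ∙ X)) ∧ X ∉ U) a Fin.elim0).ncard : ℚ) =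
      ∏ i ∈ Finset.Ico 0 a, ((p : ℚ) ^ (2 * k - (i + 1)) - (p : ℚ) ^ (i + 1)) * (p : ℚ) ^ (a - 1 - i) /
        ((p : ℚ) ^ a - (p : ℚ) ^ i) := by
  refine ncard_goodThrough (f := fun i => (p : ℚ) ^ (2 * k - (i + 1)) - (p : ℚ) ^ (i + 1)) h (fun _ h => h.1.1)
    (fun _ _ hle hW => ⟨⟨hW.1.1.mono hle, hle.trans hW.1.2⟩, fun h' => hW.2 (hle h')⟩)
    (by omega) ?_ (Nat.zero_le a) (isPartial_nil p B) ?_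
  · rintro U ⟨⟨hU, hUX⟩, hXU⟩ hUa
    have hU' : TotIso b ((ZMod p ∙ X) ⊔ U) :=
      (totIso_sup_iff h.symm hU).2 ⟨(le_orthogonal_span_singleton h.symm).1 hUX, hX⟩
    have := ncard_zeros_orthogonal h.odd h.symm h.nondeg (Pi.basisFun _ _) hU'
    rw [finrank_span_singleton_sup hXU] at this
    rw [← this]
    congr 2
    ext v
    have hexch : (v ∉ U ∧ X ∉ (ZMod p ∙ v) ⊔ U) ↔ v ∉ (ZMod p ∙ X) ⊔ U := by
      constructor
      · rintro ⟨h1, h2⟩ h3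
        apply h2
        rw [← Submodule.span_eq U, ← Submodule.span_insert] at h3 ⊢
        exact mem_span_insert_exchange h3 (by rwa [Submodule.span_eq])
      · intro h1
        refine ⟨fun h2 => h1 (Submodule.mem_sup_right h2), fun h2 => h1 ?_⟩
        rw [← Submodule.span_eq U, ← Submodule.span_insert] at h2 ⊢
        exact mem_span_insert_exchange h2 (by rwa [Submodule.span_eq])
    rw [Set.mem_sdiff, SetLike.mem_coe, ← hexch]
    simp only [Set.mem_ofPred_eq, totIso_sup_iff h.symm hU, zeros, sup_le_iff,
      Submodule.span_singleton_le_iff_mem, Submodule.mem_inf, orthogonal_sup]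
    tauto
  · rw [spanRed_nil]
    exact ⟨⟨totIso_bot, bot_le⟩, by simpa using hX0⟩

/-- Lattices whose reduction contains `X`, counted through the lifts of `X` to isotropic columns modulo `p ^ 2`. -/
theorem ncard_goodThrough_mem_redSub (h : IsReduction B b) {a : ℕ} (ha1 : 1 ≤ a) (ha : a ≤ k)
    {X : Fin (2 * k + 1) → ZMod p} (hX : b X X = 0) (hX0 : X ≠ 0) :
    ({Λ | IsGood p B Λ ∧ X ∈ redSub p Λ ∧ Module.finrank (ZMod p) (redSub p Λ) = a}.ncard : ℚ) =
      (p : ℚ) ^ (a - 1) * ∏ i ∈ Finset.Ico 1 a,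
        ((p : ℚ) ^ (2 * k - i) - (p : ℚ) ^ i) * (p : ℚ) ^ (a - 1 - i) / ((p : ℚ) ^ a - (p : ℚ) ^ i) := by
  classical
  have hp0 : (p : ℚ) ≠ 0 := by exact_mod_cast (Fact.out : p.Prime).ne_zero
  have hfin : {Λ | IsGood p B Λ ∧ X ∈ redSub p Λ ∧ Module.finrank (ZMod p) (redSub p Λ) = a}.Finite :=
    (finite_isGood p B).subset fun _ h => h.1
  have hXn : X ∉ spanRed p (Fin.elim0 : Fin 0 → (Fin (2 * k + 1) → ℤ)) := by
    rw [spanRed_nil]; simpa using hX0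
  have hXi : TotIso b ((ZMod p ∙ X) ⊔ spanRed p (Fin.elim0 : Fin 0 → (Fin (2 * k + 1) → ℤ))) := by
    rw [spanRed_nil, totIso_sup_iff h.symm totIso_bot]
    exact ⟨by simp, hX⟩
  have hcard := ncard_partial_lifts h (isPartial_nil p B) hXn hXi
  set E : Set (Fin (2 * k + 1) → ZMod p) :=
    {y | IsPartial p B (Fin.cons (rep p (X, y)) Fin.elim0 : Fin (0 + 1) → (Fin (2 * k + 1) → ℤ))} with hE
  have hEfin : E.Finite := Set.toFinite _
  set N : ℚ := ∏ i ∈ Finset.Ico 1 a,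
        ((p : ℚ) ^ (2 * k - i) - (p : ℚ) ^ i) * (p : ℚ) ^ (a - 1 - i) / ((p : ℚ) ^ a - (p : ℚ) ^ i) with hN
  have hN' : ∀ y ∈ E, ((goodThrough p B (TotIso b) a
      (Fin.cons (rep p (X, y)) Fin.elim0 : Fin (0 + 1) → (Fin (2 * k + 1) → ℤ))).ncard : ℚ) = N := by
    intro y hy
    refine ncard_goodThrough_totIso h ha ha1 hy ?_
    rw [spanRed_cons, red_rep]
    exact hXi
  have hEne : E.Nonempty := by
    rw [← Set.ncard_pos, hcard]
    exact pow_pos (Fact.out : p.Prime).pos _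
  obtain ⟨y₀, hy₀⟩ := hEne
  rw [Set.ncard_eq_toFinset_card _ hEfin] at hcard
  -- Double count the lattices against the p^{2k} lifts of X: each lattice contains p^{2k+1−a} of
  -- them, and each lift lies in N lattices. The quotient is the factor p^{a−1}.
  have hmul := Finset.card_mul_eq_card_mul (fun Λ y => rep p (X, y) ∈ Λ) (s := hfin.toFinset) (t := hEfin.toFinset)
    (m := p ^ (2 * k + 1 - a)) (n := (goodThrough p B (TotIso b) a
      (Fin.cons (rep p (X, y₀)) Fin.elim0 : Fin (0 + 1) → (Fin (2 * k + 1) → ℤ))).ncard) ?_ ?_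
  · rw [hcard, ← Set.ncard_eq_toFinset_card _ hfin] at hmul
    have hmul' := congrArg (Nat.cast (R := ℚ)) hmul
    push_cast at hmul'
    have hpow : (p : ℚ) ^ (2 * k) = p ^ (a - 1) * p ^ (2 * k + 1 - a) := by rw [← pow_add]; congr 1; omega
    rw [hN' y₀ hy₀, hpow] at hmul'
    apply mul_right_cancel₀ (pow_ne_zero (2 * k + 1 - a) hp0)
    linear_combination hmul'
  · intro Λ hΛ
    rw [Set.Finite.mem_toFinset] at hΛ
    obtain ⟨hg, hXΛ, hr⟩ := hΛ
    have h1 := hg.ncard_lifts h hXΛ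
    rw [hr] at h1
    rw [← h1, ← Set.ncard_coe_finset]
    congr 1
    ext y
    simp only [Finset.bipartiteAbove, Finset.coe_filter, Set.Finite.mem_toFinset, Set.mem_ofPred_eq, hE,
      (isPartial_nil p B).cons_iff h.symmZ, red_rep, and_iff_right_iff_imp]
    intro hy
    exact ⟨hXn, fun i => i.elim0, hg.dvd _ hy _ hy⟩
  · intro y hy
    rw [Set.Finite.mem_toFinset] at hy
    have h1 : (goodThrough p B (TotIso b) a
      (Fin.cons (rep p (X, y)) Fin.elim0 : Fin (0 + 1) → (Fin (2 * k + 1) → ℤ))).ncard = _ :=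
      Nat.cast_injective (R := ℚ) ((hN' y hy).trans (hN' y₀ hy₀).symm)
    rw [← h1, ← Set.ncard_coe_finset]
    congr 1
    ext Λ
    simp only [Finset.bipartiteBelow, Finset.coe_filter, Set.Finite.mem_toFinset, Set.mem_ofPred_eq, goodThrough,
      Fin.forall_fin_succ, Fin.cons_zero, IsEmpty.forall_iff, and_true]
    constructor
    · rintro ⟨⟨h1, h2, h3⟩, h4⟩
      exact ⟨h1, h1.totIso h, h3, h4⟩
    · rintro ⟨h1, h2, h3, h4⟩
      exact ⟨⟨h1, ⟨_, h4, red_rep _⟩, h3⟩, h4⟩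

end Counts

end IntQuad

namespace IntQuad

open scoped Matrix

/-! ### The matrix of a form and its reduction modulo p. -/

section Gram

variable {m : ℕ}

theorem polar_apply (q : QuadraticForm ℤ (Fin m → ℤ)) (x y : Fin m → ℤ) :
    q.polarBilin x y = x ⬝ᵥ gram q *ᵥ y := by
  have h : gram q = LinearMap.BilinForm.toMatrix' q.polarBilin := by
    ext i j
    rw [LinearMap.BilinForm.toMatrix'_apply]; rfl
  have h2 := Matrix.toBilin'_toMatrix' q.polarBilin
  rw [← h] at h2
  rw [← h2, Matrix.toBilin'_apply']

theorem polar_self (q : QuadraticForm ℤ (Fin m → ℤ)) (x : Fin m → ℤ) : q.polarBilin x x = 2 * q x := by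
  rw [QuadraticMap.polarBilin_apply_apply, QuadraticMap.polar_self, nsmul_eq_mul, Nat.cast_ofNat]

theorem polar_symm (q : QuadraticForm ℤ (Fin m → ℤ)) (x y : Fin m → ℤ) : q.polarBilin x y = q.polarBilin y x := by
  simp only [QuadraticMap.polarBilin_apply_apply, QuadraticMap.polar_comm]

/-- The reduction modulo `p` of the bilinear form of `q`. -/
noncomputable def redForm (q : QuadraticForm ℤ (Fin m → ℤ)) (p : ℕ) : LinearMap.BilinForm (ZMod p) (Fin m → ZMod p) :=
  Matrix.toBilin' ((gram q).map (Int.castRingHom (ZMod p)))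

theorem det_gram_map (q : QuadraticForm ℤ (Fin m → ℤ)) (p : ℕ) :
    ((gram q).map (Int.castRingHom (ZMod p))).det = (formDet q : ZMod p) := by
  have := RingHom.map_det (Int.castRingHom (ZMod p)) (gram q)
  rw [RingHom.mapMatrix_apply] at this
  rw [← this]; rfl

theorem gram_symm (q : QuadraticForm ℤ (Fin m → ℤ)) (i j : Fin m) : gram q i j = gram q j i :=
  QuadraticMap.polar_comm _ _ _

/-- The diagonal of the matrix is even, so modulo 2 the matrix agrees with an integral
skew-symmetric one, whose determinant vanishes in odd order. Consequently p ∤ det q already forces p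
to be odd. -/
theorem two_dvd_formDet (hm : Odd m) (q : QuadraticForm ℤ (Fin m → ℤ)) : (2 : ℤ) ∣ formDet q := by
  set M : Matrix (Fin m) (Fin m) ℤ :=
    Matrix.of fun i j => if i < j then gram q i j else if j < i then - gram q i j else 0 with hM
  have hT : Mᵀ = -M := by
    ext i j
    simp only [hM, Matrix.transpose_apply, Matrix.of_apply, Matrix.neg_apply, gram_symm q j i]
    rcases lt_trichotomy i j with h | h | h
    · simp [h, h.not_gt]
    · simp [h]
    · simp [h, h.not_gt]
  have hdet : M.det = 0 := by
    have h1 := congrArg Matrix.det hT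
    rw [Matrix.det_transpose, Matrix.det_neg, Fintype.card_fin, hm.neg_one_pow] at h1
    linarith
  have hmap : (gram q).map (Int.castRingHom (ZMod 2)) = M.map (Int.castRingHom (ZMod 2)) := by
    ext i j
    simp only [Matrix.map_apply, hM, Matrix.of_apply]
    rcases lt_trichotomy i j with h | h | h
    · simp [h]
    · subst h
      have h1 : gram q i i = 2 * q (Pi.single i 1) := polar_self q _
      have h2 : (2 : ZMod 2) = 0 := rfl
      simp [h1, h2]
    · simp [h, h.not_gt, ZMod.neg_eq_self_mod_two]
  have h3 := det_gram_map q 2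
  have h4 := RingHom.map_det (Int.castRingHom (ZMod 2)) M
  rw [RingHom.mapMatrix_apply] at h4
  rw [hmap, ← h4, hdet, map_zero] at h3
  exact (ZMod.intCast_zmod_eq_zero_iff_dvd _ 2).1 h3.symm

theorem isReduction_redForm {p : ℕ} [Fact p.Prime] (hm : Odd m) {q : QuadraticForm ℤ (Fin m → ℤ)}
    (hp : ¬ (p : ℤ) ∣ formDet q) : IsReduction q.polarBilin (redForm q p) where
  odd := by
    rintro rfl
    exact hp (two_dvd_formDet hm q)
  symmZ := polar_symm q
  symm := by
    rw [redForm, Matrix.isSymm_toBilin'_iff_isSymm]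
    ext i j
    simp [gram_symm q j i]
  nondeg := by
    rw [redForm, LinearMap.BilinForm.nondegenerate_toBilin'_iff_det_ne_zero, det_gram_map]
    rwa [Ne, ZMod.intCast_zmod_eq_zero_iff_dvd]
  compat := by
    intro x y
    rw [polar_apply, redForm, Matrix.toBilin'_apply']
    simp only [dotProduct, Matrix.mulVec, Matrix.map_apply, red_apply]
    push_cast
    rfl

theorem p_sq_dvd_polar_self_iff {p : ℕ} [Fact p.Prime] (hp2 : p ≠ 2) {q : QuadraticForm ℤ (Fin m → ℤ)}
    {x : Fin m → ℤ} : (p : ℤ) ^ 2 ∣ q.polarBilin x x ↔ (p : ℤ) ^ 2 ∣ q x := by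
  rw [polar_self]
  have : IsCoprime ((p : ℤ) ^ 2) 2 := by
    apply IsCoprime.pow_left
    rw [Int.isCoprime_iff_gcd_eq_one]
    exact (Nat.coprime_primes (Fact.out : p.Prime) Nat.prime_two).2 hp2
  exact ⟨fun h => this.dvd_of_dvd_mul_left h, fun h => h.mul_left 2⟩

/-- An integral quadratic form with values divisible by `n` is a multiple of an integral form. -/
theorem exists_smul_eq {n : ℤ} (hn : n ≠ 0) (Q : QuadraticForm ℤ (Fin m → ℤ)) (h : ∀ x, n ∣ Q x) :
    ∃ Q' : QuadraticForm ℤ (Fin m → ℤ), n • Q' = Q := by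
  have hpol : ∀ x y, n ∣ QuadraticMap.polar Q x y := fun x y =>
    dvd_sub (dvd_sub (h _) (h _)) (h _)
  have hdiv : ∀ {a c : ℤ}, n * c = a → a / n = c := fun {a c} hac => by
    rw [← hac, Int.mul_ediv_cancel_left _ hn]
  let P : LinearMap.BilinMap ℤ (Fin m → ℤ) ℤ := LinearMap.mk₂ ℤ (fun x y => QuadraticMap.polar Q x y / n)
    (fun x x' y => by rw [QuadraticMap.polar_add_left, Int.add_ediv_of_dvd_left (hpol _ _)])
    (fun c x y => by rw [QuadraticMap.polar_smul_left, smul_eq_mul, Int.mul_ediv_assoc _ (hpol _ _), smul_eq_mul])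
    (fun x y y' => by rw [QuadraticMap.polar_add_right, Int.add_ediv_of_dvd_left (hpol _ _)])
    (fun c x y => by rw [QuadraticMap.polar_smul_right, smul_eq_mul, Int.mul_ediv_assoc _ (hpol _ _), smul_eq_mul])
  refine ⟨{ toFun := fun x => Q x / n, toFun_smul := ?_, exists_companion' := ⟨P, ?_⟩ }, ?_⟩
  · intro a x
    rw [QuadraticMap.map_smul, smul_eq_mul, smul_eq_mul, Int.mul_ediv_assoc _ (h x)]
  · intro x y
    obtain ⟨c, hc⟩ := h (x + y)
    obtain ⟨d, hd⟩ := h x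
    obtain ⟨e, he⟩ := h y
    have h1 : P x y = QuadraticMap.polar Q x y / n := rfl
    rw [h1, QuadraticMap.polar, hdiv hc.symm, hdiv hd.symm, hdiv he.symm, hc, hd, he, ← mul_sub, ← mul_sub,
      Int.mul_ediv_cancel_left _ hn]
    ring
  · ext x
    exact Int.mul_ediv_cancel' (h x)

end Gram

/-! ### Classes of automorphs as good lattices. -/

section Correspondence

variable {m p : ℕ} [Fact p.Prime] {q q' : QuadraticForm ℤ (Fin m → ℤ)}

theorem polar_mulVec {M : Matrix (Fin m) (Fin m) ℤ} {n : ℤ} (hM : M ∈ Rep q (n • q')) (w w' : Fin m → ℤ) :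
    q.polarBilin (M *ᵥ w) (M *ᵥ w') = n * q'.polarBilin w w' := by
  have h : ∀ w, q (M *ᵥ w) = n * q' w := fun w => DFunLike.congr_fun hM w
  simp only [QuadraticMap.polarBilin_apply_apply, QuadraticMap.polar, ← Matrix.mulVec_add, h]
  ring

theorem gram_of_rep {M : Matrix (Fin m) (Fin m) ℤ} {n : ℤ} (hM : M ∈ Rep q (n • q')) :
    Mᵀ * gram q * M = n • gram q' := by
  ext i j
  have h := polar_mulVec hM (Pi.single i 1) (Pi.single j 1)
  rw [polar_apply, polar_apply] at h
  rw [Matrix.mulVec_single_one, Matrix.mulVec_single_one, Matrix.mulVec_single_one, single_one_dotProduct] at h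
  rw [Matrix.mul_assoc]
  exact h

theorem det_sq_of_rep {M : Matrix (Fin m) (Fin m) ℤ} {n : ℤ} (hM : M ∈ Rep q (n • q')) :
    M.det ^ 2 * formDet q = n ^ m * formDet q' := by
  have h := congrArg Matrix.det (gram_of_rep hM)
  rw [Matrix.det_mul, Matrix.det_mul, Matrix.det_transpose, Matrix.det_smul, Fintype.card_fin] at h
  rw [formDet, formDet, ← h]; ring

theorem mulVec_injective {M : Matrix (Fin m) (Fin m) ℤ} (hM : M.det ≠ 0) {w w' : Fin m → ℤ}
    (h : M *ᵥ w = M *ᵥ w') : w = w' := by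
  rw [← sub_eq_zero] at h ⊢
  rw [← Matrix.mulVec_sub] at h
  exact Matrix.eq_zero_of_mulVec_eq_zero hM h

theorem isCoprime_of_not_dvd {d : ℤ} (hp : ¬ (p : ℤ) ∣ d) : IsCoprime (p : ℤ) d :=
  ((Nat.prime_iff_prime_int.1 (Fact.out : p.Prime)).coprime_iff_not_dvd).2 hp

/-- Equality of the determinants gives (det M)² = p^{2m}. For the closure property both (det M)·py
and (det q)·py are shown to lie in Mℤ^m, and these two multipliers are coprime. -/
theorem isGood_range (hq : formDet q ≠ 0) (hp : ¬ (p : ℤ) ∣ formDet q) (hdet : formDet q' = formDet q)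
    {M : Matrix (Fin m) (Fin m) ℤ} (hM : M ∈ Rep q ((p : ℤ) ^ 2 • q')) :
    M.det ≠ 0 ∧ IsGood p q.polarBilin (LinearMap.range M.mulVecLin) := by
  have hp0 : (p : ℤ) ≠ 0 := by exact_mod_cast (Fact.out : p.Prime).ne_zero
  have hD : M.det ^ 2 = ((p : ℤ) ^ 2) ^ m := by
    have := det_sq_of_rep hM
    rw [hdet] at this
    exact mul_right_cancel₀ hq this
  have hD0 : M.det ≠ 0 := by
    intro h
    rw [h, zero_pow two_ne_zero] at hD
    exact pow_ne_zero m (pow_ne_zero 2 hp0) hD.symm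
  refine ⟨hD0, ?_, ?_⟩
  · rintro _ ⟨w, rfl⟩ _ ⟨w', rfl⟩
    rw [Matrix.mulVecLin_apply, Matrix.mulVecLin_apply, polar_mulVec hM]
    exact dvd_mul_right _ _
  · intro y hy
    have hcop : IsCoprime M.det (formDet q) := by
      rw [← IsCoprime.pow_left_iff (m := 2) (by norm_num), hD]
      exact ((isCoprime_of_not_dvd hp).pow_left).pow_left
    obtain ⟨u, v, huv⟩ := hcop
    have hz : ∀ i, ∃ z, (Mᵀ *ᵥ (gram q *ᵥ y)) i = p * z := by
      intro i
      obtain ⟨z, hz⟩ := hy _ ⟨Pi.single i 1, rfl⟩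
      refine ⟨z, ?_⟩
      rw [← hz, polar_apply, Matrix.mulVecLin_apply, Matrix.mulVec_single_one]
      rfl
    choose z hz using hz
    have hz' : Mᵀ *ᵥ (gram q *ᵥ y) = (p : ℤ) • z := funext hz
    have h0 : M *ᵥ (M.adjugate *ᵥ ((p : ℤ) • y)) = M.det • ((p : ℤ) • y) := by
      rw [Matrix.mulVec_mulVec, Matrix.mul_adjugate, Matrix.smul_mulVec, Matrix.one_mulVec]
    -- With Q and Q' the matrices of q and q', apply the injective matrix ᵗMQ to both sides and use
    -- ᵗMQM = p²Q' and ᵗMQy = pz; both become p² (det q) z.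
    have h1 : M *ᵥ ((gram q').adjugate *ᵥ z) = formDet q • ((p : ℤ) • y) := by
      have hdet' : (Mᵀ * gram q).det ≠ 0 := by
        rw [Matrix.det_mul, Matrix.det_transpose]
        exact mul_ne_zero hD0 hq
      apply mulVec_injective hdet'
      rw [Matrix.mulVec_mulVec, gram_of_rep hM, Matrix.smul_mulVec, Matrix.mulVec_mulVec, Matrix.mul_adjugate,
        Matrix.smul_mulVec, Matrix.one_mulVec, Matrix.mulVec_smul, Matrix.mulVec_smul, ← Matrix.mulVec_mulVec, hz',
        ← hdet]
      rw [pow_two, mul_smul, smul_comm (formDet q')]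
      rw [smul_comm (formDet q')]
      rfl
    refine ⟨u • (M.adjugate *ᵥ ((p : ℤ) • y)) + v • ((gram q').adjugate *ᵥ z), ?_⟩
    rw [Matrix.mulVecLin_apply, Matrix.mulVec_add, Matrix.mulVec_smul M u, Matrix.mulVec_smul M v, h0, h1, smul_smul u M.det, smul_smul v (formDet q),
      ← add_smul, huv, one_smul]

theorem redSub_range_ne_bot {M : Matrix (Fin m) (Fin m) ℤ} (hM : ∀ d : ℤ, (∀ i j, d ∣ M i j) → IsUnit d) :
    redSub p (LinearMap.range M.mulVecLin) ≠ ⊥ := by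
  intro h
  refine (Nat.prime_iff_prime_int.1 (Fact.out : p.Prime)).not_isUnit (hM p fun i j => ?_)
  have h1 : red p (M *ᵥ Pi.single j 1) ∈ redSub p (LinearMap.range M.mulVecLin) := ⟨_, ⟨Pi.single j 1, rfl⟩, rfl⟩
  rw [h, Submodule.mem_bot] at h1
  have := congrFun h1 i
  rw [red_apply, Matrix.mulVec_single_one] at this
  exact (ZMod.intCast_zmod_eq_zero_iff_dvd _ _).1 this

/-- A common divisor of the entries divides every coordinate of every element of Λ. Since p²L ⊂ Λ it
divides p², and it also divides some coordinate prime to p. -/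
theorem isUnit_of_dvd_entries {Λ : Submodule ℤ (Fin m → ℤ)} {B : LinearMap.BilinForm ℤ (Fin m → ℤ)}
    (hΛ : IsGood p B Λ) (hne : redSub p Λ ≠ ⊥)
    {M : Matrix (Fin m) (Fin m) ℤ} (hM : LinearMap.range M.mulVecLin = Λ) (d : ℤ) (hd : ∀ i j, d ∣ M i j) :
    IsUnit d := by
  have hdΛ : ∀ x ∈ Λ, ∀ i, d ∣ x i := by
    rw [← hM]
    rintro _ ⟨w, rfl⟩ i
    rw [Matrix.mulVecLin_apply, Matrix.mulVec, dotProduct]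
    exact Finset.dvd_sum fun j _ => (hd i j).mul_right _
  obtain ⟨_, ⟨x, hx, rfl⟩, hx0⟩ := Submodule.exists_mem_ne_zero_of_ne_bot hne
  obtain ⟨i, hi⟩ := Function.ne_iff.1 hx0
  have h1 : ¬ (p : ℤ) ∣ x i := fun h => hi ((ZMod.intCast_zmod_eq_zero_iff_dvd _ _).2 h)
  have h2 := hdΛ _ (hΛ.p_sq_smul_mem (Pi.single i 1)) i
  simp only [Pi.smul_apply, Pi.single_eq_same, smul_eq_mul, mul_one] at h2
  exact ((isCoprime_of_not_dvd h1).mul_left (isCoprime_of_not_dvd h1)).isUnit_of_dvd' h2 (hdΛ x hx i)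

/-- Because p²L ⊂ Λ, the lattice has full rank; a basis gives M, and q∘M is divisible by p² as p is
odd. It remains to see that p ∤ det q', which is where unimodularity at p is used. -/
theorem exists_rep_of_isGood (hm : Odd m) (hp : ¬ (p : ℤ) ∣ formDet q)
    {Λ : Submodule ℤ (Fin m → ℤ)} (hΛ : IsGood p q.polarBilin Λ) :
    ∃ (q' : QuadraticForm ℤ (Fin m → ℤ)) (M : Matrix (Fin m) (Fin m) ℤ), M ∈ Rep q ((p : ℤ) ^ 2 • q') ∧
      formDet q' = formDet q ∧ LinearMap.range M.mulVecLin = Λ := by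
  have h := isReduction_redForm hm hp
  have hp0 : (p : ℤ) ≠ 0 := by exact_mod_cast (Fact.out : p.Prime).ne_zero
  have hrank : Module.finrank ℤ Λ = m := by
    apply le_antisymm
    · simpa using Submodule.finrank_le Λ
    · have hinj := LinearMap.finrank_le_finrank_of_injective
        (f := (((p : ℤ) * p) • LinearMap.id : (Fin m → ℤ) →ₗ[ℤ] (Fin m → ℤ)).codRestrict Λ
          (fun y => by
            rw [LinearMap.smul_apply, mul_smul]
            exact hΛ.p_sq_smul_mem y)) (by
          intro x y hxy
          have h1 := congrArg Subtype.val hxy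
          exact smul_right_injective _ (mul_ne_zero hp0 hp0) h1)
      simpa using hinj
  let β := Module.finBasisOfFinrankEq ℤ Λ hrank
  set M : Matrix (Fin m) (Fin m) ℤ := Matrix.of fun i j => (β j : Fin m → ℤ) i with hMdef
  have hcol : M.col = fun j => (β j : Fin m → ℤ) := rfl
  have hrange : LinearMap.range M.mulVecLin = Λ := by
    rw [Matrix.range_mulVecLin, hcol]
    have h1 := congrArg (Submodule.map Λ.subtype) β.span_eq
    rw [Submodule.map_span, Submodule.map_top, Submodule.range_subtype, ← Set.range_comp] at h1
    exact h1
  have hmem : ∀ w, M *ᵥ w ∈ Λ := fun w => hrange ▸ ⟨w, rfl⟩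
  obtain ⟨q', hq'⟩ := exists_smul_eq (pow_ne_zero 2 hp0) (subst q M) fun w =>
    (p_sq_dvd_polar_self_iff (q := q) (x := M *ᵥ w) h.odd).1 (hΛ.dvd _ (hmem w) _ (hmem w))
  have hM : M ∈ Rep q ((p : ℤ) ^ 2 • q') := hq'.symm
  have hdet := det_sq_of_rep hM
  have hDdvd : M.det ∣ ((p : ℤ) ^ 2) ^ m := by
    have h1 : ∀ j, ∃ w, M *ᵥ w = (p : ℤ) • (p : ℤ) • Pi.single j 1 := by
      intro j
      have := hΛ.p_sq_smul_mem (Pi.single j 1)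
      rw [← hrange] at this
      exact this
    choose w hw using h1
    have h2 : M * (Matrix.of fun i j => w j i) = ((p : ℤ) ^ 2) • (1 : Matrix (Fin m) (Fin m) ℤ) := by
      ext i j
      have := congrFun (hw j) i
      rw [Matrix.mul_apply]
      rw [Matrix.mulVec, dotProduct] at this
      simp only [Matrix.of_apply, Matrix.smul_apply, smul_eq_mul]
      rw [this, Matrix.one_apply]
      simp only [Pi.smul_apply, smul_eq_mul, Pi.single_apply]
      ring
    have h3 := congrArg Matrix.det h2
    rw [Matrix.det_mul, Matrix.det_smul, Fintype.card_fin, Matrix.det_one, mul_one] at h3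
    exact ⟨_, h3.symm⟩
  have hD0 : M.det ≠ 0 := fun h0 => by
    rw [h0, zero_dvd_iff] at hDdvd
    exact pow_ne_zero m (pow_ne_zero 2 hp0) hDdvd
  -- Otherwise some w ≢ 0 satisfies p³ ∣ B(x, Mw) for all x ∈ Λ. Testing on p²L gives Mw = py;
  -- testing on p times the preimage of U^⊥ gives y mod p ∈ U^⊥⊥ = U, and then closure gives y ∈ Λ.
  -- Hence w ∈ pℤ^m, a contradiction.
  have hp' : ¬ (p : ℤ) ∣ formDet q' := by
    intro hdvd
    have hdet0 : ((gram q').map (Int.castRingHom (ZMod p))).det = 0 := by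
      rw [det_gram_map]; exact (ZMod.intCast_zmod_eq_zero_iff_dvd _ _).2 hdvd
    obtain ⟨w₀, hw₀, hker⟩ := Matrix.exists_mulVec_eq_zero_iff.2 hdet0
    set w := lift p w₀ with hw
    have h1 : ∀ w', (p : ℤ) ∣ q'.polarBilin w' w := by
      intro w'
      rw [← ZMod.intCast_zmod_eq_zero_iff_dvd, polar_apply]
      have : ((w' ⬝ᵥ gram q' *ᵥ w : ℤ) : ZMod p) =
          red p w' ⬝ᵥ ((gram q').map (Int.castRingHom (ZMod p))) *ᵥ red p w := by
        simp only [dotProduct, Matrix.mulVec, Matrix.map_apply, red_apply]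
        push_cast
        rfl
      rw [this, hw, red_lift, hker, dotProduct_zero]
    have h2 : ∀ x ∈ Λ, (p : ℤ) ^ 2 * p ∣ q.polarBilin x (M *ᵥ w) := by
      intro x hx
      rw [← hrange] at hx
      obtain ⟨w', rfl⟩ := hx
      rw [Matrix.mulVecLin_apply, polar_mulVec hM]
      exact mul_dvd_mul_left _ (h1 w')
    have h3 : red p (M *ᵥ w) = 0 := by
      apply h.nondeg.2
      intro v
      obtain ⟨z, rfl⟩ : ∃ z, red p z = v := ⟨_, red_lift v⟩
      rw [← h.dvd_iff]
      have := h2 _ (hΛ.p_sq_smul_mem z)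
      rw [map_smul, map_smul, LinearMap.smul_apply, LinearMap.smul_apply, smul_eq_mul, smul_eq_mul, ← mul_assoc,
        ← pow_two] at this
      exact (mul_dvd_mul_iff_left (pow_ne_zero 2 hp0)).1 this
    obtain ⟨y, hy⟩ := red_eq_zero_iff.1 h3
    have h4 : ∀ x ∈ Λ, (p : ℤ) ^ 2 ∣ q.polarBilin x y := by
      intro x hx
      have := h2 x hx
      rw [hy, map_smul, smul_eq_mul, mul_comm ((p : ℤ) ^ 2)] at this
      exact (mul_dvd_mul_iff_left hp0).1 this
    have h5 : red p y ∈ redSub p Λ := by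
      rw [← LinearMap.BilinForm.orthogonal_orthogonal h.nondeg h.symm.isRefl (redSub p Λ)]
      intro v hv
      obtain ⟨z, rfl⟩ : ∃ z, red p z = v := ⟨_, red_lift v⟩
      rw [← h.dvd_iff]
      have := h4 _ ((hΛ.p_smul_mem_iff h).2 hv)
      rw [map_smul, LinearMap.smul_apply, smul_eq_mul, pow_two] at this
      exact (mul_dvd_mul_iff_left hp0).1 this
    obtain ⟨x₀, hx₀, hx₀y⟩ := h5
    obtain ⟨u, rfl⟩ := red_eq_red_iff.1 hx₀y.symm
    have h6 : (p : ℤ) • u ∈ Λ := by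
      refine hΛ.closed u fun x hx => ?_
      have h7 := h4 x hx
      rw [map_add, map_smul, smul_eq_mul, Int.dvd_add_right (hΛ.dvd x hx x₀ hx₀), pow_two] at h7
      exact (mul_dvd_mul_iff_left hp0).1 h7
    have h8 : x₀ + (p : ℤ) • u ∈ LinearMap.range M.mulVecLin := hrange ▸ add_mem hx₀ h6
    obtain ⟨w', hw'⟩ := h8
    have h9 : w = (p : ℤ) • w' := by
      apply mulVec_injective hD0
      rw [Matrix.mulVec_smul, hy, ← hw', Matrix.mulVecLin_apply]
    apply hw₀
    rw [← red_lift w₀, ← hw, h9, red_p_smul]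
  refine ⟨q', M, hM, ?_, hrange⟩
  -- In (det M)² det q = p^{2m} det q' both determinants of forms are prime to p and det M divides
  -- p^{2m}, so (det M)² and p^{2m} divide each other.
  have c1 : IsCoprime (((p : ℤ) ^ 2) ^ m) (formDet q) := ((isCoprime_of_not_dvd hp).pow_left).pow_left
  have c2 : IsCoprime (M.det ^ 2) (formDet q') :=
    (IsCoprime.of_isCoprime_of_dvd_left (((isCoprime_of_not_dvd hp').pow_left).pow_left) hDdvd).pow_left
  have d1 : ((p : ℤ) ^ 2) ^ m ∣ M.det ^ 2 := c1.dvd_of_dvd_mul_right (hdet ▸ dvd_mul_right _ _)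
  have d2 : M.det ^ 2 ∣ ((p : ℤ) ^ 2) ^ m := c2.dvd_of_dvd_mul_right (hdet ▸ dvd_mul_right _ _)
  have heq : M.det ^ 2 = ((p : ℤ) ^ 2) ^ m := Int.dvd_antisymm (by positivity) (by positivity) d2 d1
  rw [heq] at hdet
  exact (mul_left_cancel₀ (pow_ne_zero m (pow_ne_zero 2 hp0)) hdet).symm

/-- The lattice `M ℤ^m` attached to the class of `M`. -/
def AutClass.lattice {a : ℤ} (c : AutClass q q' a) : Submodule ℤ (Fin m → ℤ) :=
  Quotient.liftOn c (fun M => LinearMap.range M.1.mulVecLin) (by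
    rintro M N ⟨U, -, h⟩
    have hr : LinearMap.range (U : Matrix (Fin m) (Fin m) ℤ).mulVecLin = ⊤ := by
      rw [LinearMap.range_eq_top]
      intro x
      refine ⟨((U⁻¹ : GL (Fin m) ℤ) : Matrix (Fin m) (Fin m) ℤ) *ᵥ x, ?_⟩
      rw [Matrix.mulVecLin_apply, Matrix.mulVec_mulVec, ← Units.val_mul, mul_inv_cancel, Units.val_one,
        Matrix.one_mulVec]
    change LinearMap.range M.1.mulVecLin = LinearMap.range N.1.mulVecLin
    rw [h, Matrix.mulVecLin_mul, LinearMap.range_comp, hr, Submodule.map_top])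

theorem AutClass.leftDvd_iff {a : ℤ} (c : AutClass q q' a) (K : Fin m → ℤ) : c.LeftDvd K ↔ K ∈ c.lattice := by
  induction c using Quotient.inductionOn with
  | h M => exact ⟨fun ⟨L, hL⟩ => ⟨L, hL.symm⟩, fun ⟨L, hL⟩ => ⟨L, hL.symm⟩⟩

theorem exists_unit_of_range_eq {M N : Matrix (Fin m) (Fin m) ℤ} (hM : M.det ≠ 0) (hN : N.det ≠ 0)
    (h : LinearMap.range M.mulVecLin = LinearMap.range N.mulVecLin) :
    ∃ U : GL (Fin m) ℤ, N = M * (U : Matrix (Fin m) (Fin m) ℤ) := by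
  have key : ∀ {M N : Matrix (Fin m) (Fin m) ℤ}, LinearMap.range N.mulVecLin ≤ LinearMap.range M.mulVecLin →
      ∃ U : Matrix (Fin m) (Fin m) ℤ, N = M * U := by
    intro M N h
    have h1 : ∀ j, ∃ w, M *ᵥ w = N *ᵥ Pi.single j 1 := fun j => h ⟨Pi.single j 1, rfl⟩
    choose w hw using h1
    refine ⟨Matrix.of fun i j => w j i, ?_⟩
    ext i j
    have := congrFun (hw j) i
    rw [Matrix.mulVec_single_one] at this
    exact this.symm
  obtain ⟨U, hU⟩ := key h.ge
  obtain ⟨U', hU'⟩ := key h.le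
  have hcancel : ∀ {M U V : Matrix (Fin m) (Fin m) ℤ}, M.det ≠ 0 → M = M * U * V → U * V = 1 := by
    intro M U V hM h
    rw [Matrix.mul_assoc] at h
    apply Matrix.ext_of_mulVec_single
    intro j
    apply mulVec_injective hM
    rw [Matrix.mulVec_mulVec, ← h, Matrix.one_mulVec]
  exact ⟨⟨U, U', hcancel hM (by rw [← hU, ← hU']), hcancel hN (by rw [← hU', ← hU])⟩, hU⟩

theorem subst_eq_of_rep {q'' : QuadraticForm ℤ (Fin m → ℤ)} {n : ℤ} (hn : n ≠ 0)
    {M U : Matrix (Fin m) (Fin m) ℤ} (hM : M ∈ Rep q (n • q')) (hN : M * U ∈ Rep q (n • q'')) : U ∈ Rep q' q'' := by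
  ext w
  have h1 : q (M *ᵥ (U *ᵥ w)) = n * q' (U *ᵥ w) := DFunLike.congr_fun hM _
  have h2 : q ((M * U) *ᵥ w) = n * q'' w := DFunLike.congr_fun hN _
  rw [← Matrix.mulVec_mulVec, h1] at h2
  exact mul_left_cancel₀ hn h2

theorem equivalent_of_mem_rep {U : GL (Fin m) ℤ} (hU : (U : Matrix (Fin m) (Fin m) ℤ) ∈ Rep q q') :
    q.Equivalent q' := by
  refine QuadraticMap.Equivalent.symm ⟨⟨LinearMap.GeneralLinearGroup.generalLinearEquiv ℤ _
    (Matrix.GeneralLinearGroup.toLin U), fun w => ?_⟩⟩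
  exact DFunLike.congr_fun hU w

variable {ι : Type*} {r : ι → QuadraticForm ℤ (Fin m → ℤ)}

/-- The classes of automorphs that divide `K` correspond to the good lattices through `K`. -/
theorem bijective_lattice (hm : Odd m) (hq : formDet q ≠ 0) (hp : ¬ (p : ℤ) ∣ formDet q)
    (hr : IsCompleteSystem q r) (K : Fin m → ℤ) :
    ∃ f : (Σ i : ι, {c : AutClass q (r i) ((p : ℤ) ^ 2) // c.LeftDvd K}) →
      {Λ // IsGood p q.polarBilin Λ ∧ redSub p Λ ≠ ⊥ ∧ K ∈ Λ}, Function.Bijective f := by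
  have hp0 : (p : ℤ) ≠ 0 := by exact_mod_cast (Fact.out : p.Prime).ne_zero
  refine ⟨fun c => ⟨c.2.1.lattice, ?_⟩, ?_, ?_⟩
  · obtain ⟨i, c, hc⟩ := c
    rw [AutClass.leftDvd_iff] at hc
    induction c using Quotient.inductionOn with
    | h M => exact ⟨(isGood_range hq hp (hr.similar i).1 M.2.1).2, redSub_range_ne_bot M.2.2, hc⟩
  · rintro ⟨i, c, hc⟩ ⟨j, d, hd⟩ heq
    have heq : c.lattice = d.lattice := congrArg Subtype.val heq
    induction c using Quotient.inductionOn with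
    | h M =>
    induction d using Quotient.inductionOn with
    | h N =>
    obtain ⟨U, hU⟩ := exists_unit_of_range_eq (isGood_range hq hp (hr.similar i).1 M.2.1).1
      (isGood_range hq hp (hr.similar j).1 N.2.1).1 heq
    have hUr : (U : Matrix (Fin m) (Fin m) ℤ) ∈ Rep (r i) (r j) :=
      subst_eq_of_rep (pow_ne_zero 2 hp0) M.2.1 (hU ▸ N.2.1)
    obtain rfl := hr.inequivalent i j (equivalent_of_mem_rep hUr)
    have : (Quotient.mk _ M : AutClass q (r i) ((p : ℤ) ^ 2)) = Quotient.mk _ N := Quotient.sound ⟨U, hUr, hU⟩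
    exact Sigma.ext rfl (heq_of_eq (Subtype.ext this))
  · rintro ⟨Λ, hΛ, hne, hK⟩
    obtain ⟨q', M, hM, hdet, hrange⟩ := exists_rep_of_isGood hm hp hΛ
    -- M itself witnesses that q' is similar to q, with multiplier p². Composing M with the inverse
    -- equivalence replaces q' by its representative without changing the lattice.
    obtain ⟨i, ⟨e⟩⟩ := hr.exhaustive q' ⟨hdet, (p : ℤ) ^ 2, (isCoprime_of_not_dvd hp).pow_left, M, hM⟩
    set N := M * LinearMap.toMatrix' (e.symm.toLinearEquiv : (Fin m → ℤ) →ₗ[ℤ] (Fin m → ℤ)) with hN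
    have hNapp : ∀ w, N *ᵥ w = M *ᵥ (e.symm w) := by
      intro w
      rw [hN, ← Matrix.mulVec_mulVec, LinearMap.toMatrix'_mulVec]; rfl
    have hNrange : LinearMap.range N.mulVecLin = Λ := by
      rw [← hrange]
      ext x
      constructor
      · rintro ⟨w, rfl⟩
        exact ⟨e.symm w, (hNapp w).symm⟩
      · rintro ⟨w, rfl⟩
        refine ⟨e w, ?_⟩
        rw [Matrix.mulVecLin_apply, hNapp]
        exact congrArg (M *ᵥ ·) (e.toLinearEquiv.symm_apply_apply w)
    have hNrep : N ∈ Rep q ((p : ℤ) ^ 2 • r i) := by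
      ext w
      have h1 : q (M *ᵥ (e.symm w)) = (p : ℤ) ^ 2 * q' (e.symm w) := DFunLike.congr_fun hM _
      change q (N *ᵥ w) = (p : ℤ) ^ 2 * r i w
      rw [hNapp, h1, e.symm.map_app]
    refine ⟨⟨i, Quotient.mk _ ⟨N, hNrep, fun d => isUnit_of_dvd_entries hΛ hne hNrange d⟩, ?_⟩, Subtype.ext hNrange⟩
    refine (AutClass.leftDvd_iff (Quotient.mk _ _) K).2 ?_
    change K ∈ LinearMap.range N.mulVecLin
    rwa [hNrange]

end Correspondence

end IntQuad

namespace IntQuad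

/-! ### Evaluation of the products and sums in c_p and β_p. -/

section Algebra

open Finset

variable (p k : ℕ)

/-- The common product in `c_p` and `β_p`. -/
def baseProd (a : ℕ) : ℚ :=
  ∏ i ∈ Icc 1 (a - 1), ((p : ℚ) ^ (2 * (k - i)) - 1) / (1 - (p : ℚ) ^ (-(i : ℤ)))

/-- The product `∏_{i=1}^{a-1} p^{i-1} / (p^i - 1)`. -/
def denProd (a : ℕ) : ℚ := ∏ i ∈ Ico 1 a, (p : ℚ) ^ (i - 1) / ((p : ℚ) ^ i - 1)

variable {p k}

theorem pow_sub_one_ne_zero (hp : 1 < p) {i : ℕ} (hi : 1 ≤ i) : (p : ℚ) ^ i - 1 ≠ 0 := by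
  have : (1 : ℚ) < (p : ℚ) ^ i := one_lt_pow₀ (by exact_mod_cast hp) (by omega)
  exact (sub_pos.2 this).ne'

theorem baseProd_eq (hp : 1 < p) {a : ℕ} (ha : 1 ≤ a) :
    baseProd p k a = (p : ℚ) ^ (a - 1) * (∏ i ∈ Ico 1 a, ((p : ℚ) ^ (2 * (k - i)) - 1)) * denProd p a := by
  have hp0 : (p : ℚ) ≠ 0 := by positivity
  have hs : Icc 1 (a - 1) = Ico 1 a := by ext i; simp only [mem_Icc, mem_Ico]; omega
  have hpow : (p : ℚ) ^ (a - 1) = ∏ i ∈ Ico 1 a, (p : ℚ) := by simp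
  rw [baseProd, denProd, hs, hpow, ← prod_mul_distrib, ← prod_mul_distrib]
  refine prod_congr rfl fun i hi => ?_
  have hi1 := (mem_Ico.1 hi).1
  have h1 := pow_sub_one_ne_zero hp hi1
  obtain ⟨j, rfl⟩ : ∃ j, i = j + 1 := ⟨i - 1, by omega⟩
  rw [zpow_neg, zpow_natCast, Nat.add_sub_cancel]
  have h2 : (1 : ℚ) - ((p : ℚ) ^ (j + 1))⁻¹ = ((p : ℚ) ^ (j + 1) - 1) / (p : ℚ) ^ (j + 1) := by
    field_simp
  rw [h2]
  field_simp
  ring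

/-- Substitute i ↦ a − i, after taking p^i out of p^a − p^i. -/
theorem prod_den_reflect (hp : 1 < p) (a : ℕ) :
    ∏ i ∈ Ico 1 a, (p : ℚ) ^ i * (p : ℚ) ^ (a - 1 - i) / ((p : ℚ) ^ a - (p : ℚ) ^ i) = denProd p a := by
  have hp0 : (p : ℚ) ≠ 0 := by positivity
  have h := prod_Ico_reflect (fun i => (p : ℚ) ^ (i - 1) / ((p : ℚ) ^ i - 1)) 1 (m := a) (n := a) (by omega)
  rw [Nat.add_sub_cancel_left, Nat.add_sub_cancel] at h
  rw [denProd, ← h]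
  refine prod_congr rfl fun i hi => ?_
  obtain ⟨h1, h2⟩ := mem_Ico.1 hi
  have h3 : (p : ℚ) ^ a = (p : ℚ) ^ i * (p : ℚ) ^ (a - i) := by rw [← pow_add]; congr 1; omega
  have h4 := pow_sub_one_ne_zero hp (show 1 ≤ a - i by omega)
  rw [h3, ← mul_sub_one, mul_div_mul_left _ _ (pow_ne_zero i hp0), show a - 1 - i = a - i - 1 by omega]

theorem prod_Ico_zero (hp : 1 < p) {a : ℕ} (ha : 1 ≤ a) {g h : ℕ → ℚ} (hg : ∀ i < a, g i = (p : ℚ) ^ i * h i) :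
    ∏ i ∈ Ico 0 a, g i * (p : ℚ) ^ (a - 1 - i) / ((p : ℚ) ^ a - (p : ℚ) ^ i) =
      (∏ i ∈ Ico 0 a, h i) * ((p : ℚ) ^ (a - 1) / ((p : ℚ) ^ a - 1)) * denProd p a := by
  have h1 : ∏ i ∈ Ico 0 a, g i * (p : ℚ) ^ (a - 1 - i) / ((p : ℚ) ^ a - (p : ℚ) ^ i) =
      (∏ i ∈ Ico 0 a, h i) * ∏ i ∈ Ico 0 a, (p : ℚ) ^ i * (p : ℚ) ^ (a - 1 - i) / ((p : ℚ) ^ a - (p : ℚ) ^ i) := by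
    rw [← prod_mul_distrib]
    refine prod_congr rfl fun i hi => ?_
    rw [hg i (mem_Ico.1 hi).2]; ring
  rw [h1, prod_eq_prod_Ico_succ_bot (show 0 < a by omega) (fun i => (p : ℚ) ^ i * _ / _), zero_add,
    prod_den_reflect hp]
  simp only [pow_zero, one_mul, Nat.sub_zero]
  ring

theorem pow_sub_pow {i : ℕ} (hi : i ≤ k) :
    (p : ℚ) ^ (2 * k - i) - (p : ℚ) ^ i = (p : ℚ) ^ i * ((p : ℚ) ^ (2 * (k - i)) - 1) := by
  rw [mul_sub_one, ← pow_add]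
  congr 2; omega

theorem prod_totIso_one (hp : 1 < p) {a : ℕ} (ha : 1 ≤ a) (hak : a ≤ k) :
    ∏ i ∈ Ico 1 a, ((p : ℚ) ^ (2 * k - i) - (p : ℚ) ^ i) * (p : ℚ) ^ (a - 1 - i) / ((p : ℚ) ^ a - (p : ℚ) ^ i) =
      baseProd p k a * (p : ℚ) ^ (1 - (a : ℤ)) := by
  have hp0 : (p : ℚ) ≠ 0 := by positivity
  have h1 : (p : ℚ) ^ (1 - (a : ℤ)) = ((p : ℚ) ^ (a - 1))⁻¹ := by
    rw [← zpow_natCast, ← zpow_neg]; congr 1; omega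
  rw [baseProd_eq hp ha, h1, ← prod_den_reflect hp]
  have h2 : ∀ x y : ℚ, (p : ℚ) ^ (a - 1) * x * y * ((p : ℚ) ^ (a - 1))⁻¹ = x * y := by
    intro x y; field_simp
  rw [h2, ← prod_mul_distrib]
  refine prod_congr rfl fun i hi => ?_
  rw [pow_sub_pow (by have := (mem_Ico.1 hi).2; omega)]
  ring

theorem prod_totIso_zero (hp : 1 < p) {a : ℕ} (ha : 1 ≤ a) (hak : a ≤ k) :
    ∏ i ∈ Ico 0 a, ((p : ℚ) ^ (2 * k - i) - (p : ℚ) ^ i) * (p : ℚ) ^ (a - 1 - i) / ((p : ℚ) ^ a - (p : ℚ) ^ i) =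
      baseProd p k a * (((p : ℚ) ^ (2 * k) - 1) / ((p : ℚ) ^ a - 1)) := by
  rw [prod_Ico_zero hp ha (h := fun i => (p : ℚ) ^ (2 * (k - i)) - 1) (fun i hi => pow_sub_pow (by omega)),
    baseProd_eq hp ha, prod_eq_prod_Ico_succ_bot (show 0 < a by omega), Nat.sub_zero, zero_add]
  ring

theorem prod_isotropic (hp : 1 < p) {a : ℕ} (ha : 1 ≤ a) (hak : a ≤ k) :
    ∏ i ∈ Ico 0 a, ((p : ℚ) ^ (2 * k - (i + 1)) - (p : ℚ) ^ (i + 1)) * (p : ℚ) ^ (a - 1 - i) /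
        ((p : ℚ) ^ a - (p : ℚ) ^ i) =
      baseProd p k a * (((p : ℚ) ^ (2 * k - a) - (p : ℚ) ^ a) / ((p : ℚ) ^ a - 1)) := by
  rw [prod_Ico_zero hp ha (h := fun i => (p : ℚ) * ((p : ℚ) ^ (2 * (k - (i + 1))) - 1))
    (fun i hi => by rw [pow_sub_pow (by omega)]; ring), baseProd_eq hp ha, prod_mul_distrib]
  have h1 := prod_Ico_add' (fun i => (p : ℚ) ^ (2 * (k - i)) - 1) 0 a 1
  rw [zero_add, prod_Ico_succ_top ha] at h1
  rw [h1, pow_sub_pow hak]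
  simp only [prod_const, Nat.card_Ico, Nat.sub_zero]
  ring

/-- As η² = 1, the second factor at one index and the first factor at the next multiply to (p^{k−a}
+ η)(p^{k−a} − η) = p^{2(k−a)} − 1, leaving only the two outer factors. -/
theorem prod_telescope {η : ℚ} (hη : η ^ 2 = 1) {a : ℕ} (ha : 1 ≤ a) (hak : a ≤ k) :
    ∏ i ∈ Ico 0 a, ((p : ℚ) ^ (k - i) - η) * ((p : ℚ) ^ (k - (i + 1)) + η) =
      ((p : ℚ) ^ k - η) * ((p : ℚ) ^ (k - a) + η) * ∏ i ∈ Ico 1 a, ((p : ℚ) ^ (2 * (k - i)) - 1) := by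
  induction a, ha using Nat.le_induction with
  | base => simp
  | succ a ha ih =>
    rw [prod_Ico_succ_top (Nat.zero_le a), ih (by omega), prod_Ico_succ_top ha, mul_comm 2 (k - a), pow_mul]
    linear_combination (((p : ℚ) ^ k - η) * (∏ i ∈ Ico 1 a, ((p : ℚ) ^ (2 * (k - i)) - 1)) *
      ((p : ℚ) ^ (k - (a + 1)) + η)) * (-hη)

/-- For η² = 1 each numerator splits as p^i (p^{k−i} − η)(p^{k−i−1} + η), which brings the product
into telescoping form. -/
theorem prod_anisotropic (hp : 1 < p) {η : ℚ} (hη : η ^ 2 = 1) {a : ℕ} (ha : 1 ≤ a) (hak : a ≤ k) :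
    ∏ i ∈ Ico 0 a, ((p : ℚ) ^ (2 * k - 1 - i) - (p : ℚ) ^ i + η * ((p : ℚ) ^ k - (p : ℚ) ^ (k - 1))) *
        (p : ℚ) ^ (a - 1 - i) / ((p : ℚ) ^ a - (p : ℚ) ^ i) =
      baseProd p k a * (((p : ℚ) ^ k - η) * ((p : ℚ) ^ (k - a) + η) / ((p : ℚ) ^ a - 1)) := by
  rw [prod_Ico_zero hp ha (h := fun i => ((p : ℚ) ^ (k - i) - η) * ((p : ℚ) ^ (k - (i + 1)) + η)) ?_,
    baseProd_eq hp ha, prod_telescope hη ha hak]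
  · ring
  · intro i hi
    have e1 : (p : ℚ) ^ (2 * k - 1 - i) = (p : ℚ) ^ i * ((p : ℚ) ^ (k - i) * (p : ℚ) ^ (k - (i + 1))) := by
      rw [← pow_add, ← pow_add]; congr 1; omega
    have e2 : (p : ℚ) ^ k = (p : ℚ) ^ i * (p : ℚ) ^ (k - i) := by rw [← pow_add]; congr 1; omega
    have e3 : (p : ℚ) ^ (k - 1) = (p : ℚ) ^ i * (p : ℚ) ^ (k - (i + 1)) := by rw [← pow_add]; congr 1; omega
    rw [e1, e2, e3]
    linear_combination ((p : ℚ) ^ i) * hη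

theorem cConst_eq : cConst p k = ∑ a ∈ Icc 1 k, baseProd p k a * (p : ℚ) ^ (1 - (a : ℤ)) := rfl

theorem betaConst_eq : betaConst p k = ∑ a ∈ Icc 1 k, baseProd p k a *
    (((p : ℚ) ^ (2 * k + 1 - 2) - (p : ℚ) ^ (a - 1) * ((p : ℚ) + 1) + 1) /
        ((p : ℚ) ^ (a - 1) * ((p : ℚ) ^ a - 1))) := rfl

/-- All terms are nonnegative and the term a = 1 equals 1. This is needed to cancel c_p against
c_p⁻¹β_p. -/
theorem cConst_ne_zero (hp : 1 < p) (hk : 1 ≤ k) : cConst p k ≠ 0 := by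
  have hp1 : (1 : ℚ) < p := by exact_mod_cast hp
  have hp0 : (0 : ℚ) < p := by linarith
  have hnn : ∀ a ∈ Icc 1 k, 0 ≤ baseProd p k a * (p : ℚ) ^ (1 - (a : ℤ)) := by
    intro a _
    refine mul_nonneg (prod_nonneg fun i _ => div_nonneg ?_ ?_) (zpow_nonneg hp0.le _)
    · exact sub_nonneg.2 (one_le_pow₀ hp1.le)
    · rw [zpow_neg, zpow_natCast]
      exact sub_nonneg.2 (inv_le_one_of_one_le₀ (one_le_pow₀ hp1.le))
  rw [cConst_eq]
  refine (sum_pos' hnn ⟨1, by simp [hk], ?_⟩).ne'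
  simp [baseProd]

theorem cConst_add_betaConst_term (hp : 1 < p) {a : ℕ} (ha : 1 ≤ a) (hak : a ≤ k) :
    (p : ℚ) ^ (1 - (a : ℤ)) + (((p : ℚ) ^ (2 * k + 1 - 2) - (p : ℚ) ^ (a - 1) * ((p : ℚ) + 1) + 1) /
        ((p : ℚ) ^ (a - 1) * ((p : ℚ) ^ a - 1))) = ((p : ℚ) ^ (2 * k - a) - 1) / ((p : ℚ) ^ a - 1) := by
  have hp0 : (p : ℚ) ≠ 0 := by positivity
  have h1 : (p : ℚ) ^ (1 - (a : ℤ)) = ((p : ℚ) ^ (a - 1))⁻¹ := by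
    rw [← zpow_natCast, ← zpow_neg]; congr 1; omega
  have h2 : (p : ℚ) ^ (2 * k + 1 - 2) = (p : ℚ) ^ (a - 1) * (p : ℚ) ^ (2 * k - a) := by
    rw [← pow_add]; congr 1; omega
  have h3 : (p : ℚ) ^ a = (p : ℚ) ^ (a - 1) * p := by rw [← pow_succ]; congr 1; omega
  have h4 := pow_sub_one_ne_zero hp ha
  rw [h1, h2]
  have h5 : (p : ℚ) ^ (a - 1) ≠ 0 := pow_ne_zero _ hp0
  field_simp
  rw [h3]; ring

/-- `c_p + β_p` as one sum. -/
theorem cConst_add_betaConst (hp : 1 < p) :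
    cConst p k + betaConst p k =
      ∑ a ∈ Icc 1 k, baseProd p k a * (((p : ℚ) ^ (2 * k - a) - 1) / ((p : ℚ) ^ a - 1)) := by
  rw [cConst_eq, betaConst_eq, ← sum_add_distrib]
  refine sum_congr rfl fun a ha => ?_
  obtain ⟨h1, h2⟩ := mem_Icc.1 ha
  rw [← mul_add, cConst_add_betaConst_term hp h1 h2]

/-- Termwise, p^{2k} − 1 = (p^{2k−a} − 1) + p^{2k−a}(p^a − 1); the second summand gives p^{m−2} c_p.
-/
theorem sum_totIso_zero (hp : 1 < p) :
    ∑ a ∈ Icc 1 k, baseProd p k a * (((p : ℚ) ^ (2 * k) - 1) / ((p : ℚ) ^ a - 1)) =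
      cConst p k + betaConst p k + (p : ℚ) ^ (2 * k + 1 - 2) * cConst p k := by
  have hp0 : (p : ℚ) ≠ 0 := by positivity
  rw [cConst_add_betaConst hp, cConst_eq, mul_sum, ← sum_add_distrib]
  refine sum_congr rfl fun a ha => ?_
  obtain ⟨h1, h2⟩ := mem_Icc.1 ha
  have e1 : (p : ℚ) ^ (2 * k + 1 - 2) * (p : ℚ) ^ (1 - (a : ℤ)) = (p : ℚ) ^ (2 * k - a) := by
    rw [← zpow_natCast, ← zpow_natCast, ← zpow_add₀ hp0]; congr 1; omega
  have e2 : (p : ℚ) ^ (2 * k) = (p : ℚ) ^ a * (p : ℚ) ^ (2 * k - a) := by rw [← pow_add]; congr 1; omega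
  have h4 := pow_sub_one_ne_zero hp h1
  rw [mul_left_comm, e1, e2]
  field_simp
  ring

theorem sum_isotropic (hp : 1 < p) :
    ∑ a ∈ Icc 1 k, (baseProd p k a * (((p : ℚ) ^ (2 * k - a) - (p : ℚ) ^ a) / ((p : ℚ) ^ a - 1)) +
      baseProd p k a) = cConst p k + betaConst p k := by
  rw [cConst_add_betaConst hp]
  refine sum_congr rfl fun a ha => ?_
  have h4 := pow_sub_one_ne_zero hp (mem_Icc.1 ha).1
  field_simp
  ring

/-- Termwise, (p^k − η)(p^{k−a} + η) = (p^{2k−a} − 1) + η p^{k−a}(p^a − 1); the second summand gives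
η p^{k−1} c_p. -/
theorem sum_anisotropic (hp : 1 < p) {η : ℚ} (hη : η ^ 2 = 1) :
    ∑ a ∈ Icc 1 k, baseProd p k a * (((p : ℚ) ^ k - η) * ((p : ℚ) ^ (k - a) + η) / ((p : ℚ) ^ a - 1)) =
      cConst p k + betaConst p k + η * (p : ℚ) ^ (k - 1) * cConst p k := by
  have hp0 : (p : ℚ) ≠ 0 := by positivity
  rw [cConst_add_betaConst hp, cConst_eq, mul_sum, ← sum_add_distrib]
  refine sum_congr rfl fun a ha => ?_
  obtain ⟨h1, h2⟩ := mem_Icc.1 ha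
  have e1 : (p : ℚ) ^ (k - 1) * (p : ℚ) ^ (1 - (a : ℤ)) = (p : ℚ) ^ (k - a) := by
    rw [← zpow_natCast, ← zpow_natCast, ← zpow_add₀ hp0]; congr 1; omega
  have e2 : (p : ℚ) ^ k = (p : ℚ) ^ a * (p : ℚ) ^ (k - a) := by rw [← pow_add]; congr 1; omega
  have e3 : (p : ℚ) ^ (2 * k - a) = (p : ℚ) ^ a * (p : ℚ) ^ (k - a) * (p : ℚ) ^ (k - a) := by
    rw [← pow_add, ← pow_add]; congr 1; omega
  have h4 := pow_sub_one_ne_zero hp h1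
  have e4 : η * (p : ℚ) ^ (k - 1) * (baseProd p k a * (p : ℚ) ^ (1 - (a : ℤ))) =
      baseProd p k a * (η * (p : ℚ) ^ (k - a)) := by rw [← e1]; ring
  rw [e4, e2, e3, ← mul_add]
  congr 1
  rw [div_add' _ _ _ h4]
  congr 1
  linear_combination -hη

end Algebra

/-! ### The case distinction on K and the final count. -/

section Main

variable {k p : ℕ} [Fact p.Prime] {q : QuadraticForm ℤ (Fin (2 * k + 1) → ℤ)}

theorem ncard_through_eq_sum {B : LinearMap.BilinForm ℤ (Fin (2 * k + 1) → ℤ)}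
    {b : LinearMap.BilinForm (ZMod p) (Fin (2 * k + 1) → ZMod p)} (h : IsReduction B b) (K : Fin (2 * k + 1) → ℤ) :
    ({Λ | IsGood p B Λ ∧ redSub p Λ ≠ ⊥ ∧ K ∈ Λ}.ncard : ℚ) = ∑ a ∈ Finset.Icc 1 k,
      ({Λ | IsGood p B Λ ∧ K ∈ Λ ∧ Module.finrank (ZMod p) (redSub p Λ) = a}.ncard : ℚ) := by
  classical
  have hfin : {Λ | IsGood p B Λ ∧ redSub p Λ ≠ ⊥ ∧ K ∈ Λ}.Finite := (finite_isGood p B).subset fun _ h => h.1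
  rw [Set.ncard_eq_toFinset_card _ hfin, Finset.card_eq_sum_card_fiberwise
    (f := fun Λ => Module.finrank (ZMod p) (redSub p Λ)) (t := Finset.Icc 1 k), Nat.cast_sum]
  · refine Finset.sum_congr rfl fun a ha => ?_
    rw [← Set.ncard_coe_finset]
    congr 2
    ext Λ
    simp only [Finset.coe_filter, Set.Finite.mem_toFinset, Set.mem_ofPred_eq]
    constructor
    · rintro ⟨⟨h1, -, h3⟩, h4⟩
      exact ⟨h1, h3, h4⟩
    · rintro ⟨h1, h2, h3⟩
      refine ⟨⟨h1, ?_, h2⟩, h3⟩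
      intro h4
      rw [h4, finrank_bot] at h3
      have := (Finset.mem_Icc.1 ha).1
      omega
  · intro Λ hΛ
    rw [Finset.mem_coe, Set.Finite.mem_toFinset] at hΛ
    obtain ⟨h1, h2, -⟩ := hΛ
    rw [Finset.mem_coe, Finset.mem_Icc]
    exact ⟨Submodule.one_le_finrank_iff.2 h2, (h1.totIso h).finrank_le h.nondeg (by simp)⟩

/-- The number of good lattices through `K`. -/
theorem ncard_through (hk : 1 ≤ k) (hp : ¬ (p : ℤ) ∣ formDet q) {K : Fin (2 * k + 1) → ℤ} (hK : (p : ℤ) ^ 2 ∣ q K) :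
    ({Λ | IsGood p q.polarBilin Λ ∧ redSub p Λ ≠ ⊥ ∧ K ∈ Λ}.ncard : ℚ) =
      cConst p k * (1 + ((eps p (q K / (p : ℤ) ^ 2) : ℚ) * (chi q p : ℚ) * (p : ℚ) ^ (k - 1)
              + (cConst p k)⁻¹ * betaConst p k) * delta (fun i => (p : ℚ)⁻¹ * (K i : ℚ))
          + (p : ℚ) ^ (2 * k + 1 - 2) * delta (fun i => ((p : ℚ) ^ 2)⁻¹ * (K i : ℚ))) := by
  have h := isReduction_redForm (odd_two_mul_add_one k) hp
  have hp1 : 1 < p := (Fact.out : p.Prime).one_lt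
  have hpQ : (p : ℚ) ≠ 0 := by positivity
  have hpZ : (p : ℤ) ≠ 0 := by positivity
  have hc := cConst_ne_zero hp1 hk
  rw [ncard_through_eq_sum h]
  have hδ1 : (∃ X, K = (p : ℤ) • X) ↔ ∃ Y : Fin (2 * k + 1) → ℤ, ∀ i, (p : ℚ)⁻¹ * (K i : ℚ) = Y i := by
    refine exists_congr fun Y => ?_
    rw [funext_iff]
    refine forall_congr' fun i => ?_
    rw [inv_mul_eq_iff_eq_mul₀ hpQ]
    exact_mod_cast Iff.rfl
  have hδ2 : (∃ X, K = (p : ℤ) • (p : ℤ) • X) ↔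
      ∃ Y : Fin (2 * k + 1) → ℤ, ∀ i, ((p : ℚ) ^ 2)⁻¹ * (K i : ℚ) = Y i := by
    refine exists_congr fun Y => ?_
    rw [funext_iff]
    refine forall_congr' fun i => ?_
    rw [inv_mul_eq_iff_eq_mul₀ (pow_ne_zero 2 hpQ), pow_two, mul_assoc]
    exact_mod_cast Iff.rfl
  -- If K is not divisible by p, its reduction is a nonzero isotropic vector and K is a partial
  -- tuple of length one.
  by_cases h1 : ∃ X, K = (p : ℤ) • X
  swap
  · have h2 : ¬ ∃ X, K = (p : ℤ) • (p : ℤ) • X := fun ⟨X, hX⟩ => h1 ⟨_, hX⟩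
    rw [delta, delta, if_neg (hδ1.not.1 h1), if_neg (hδ2.not.1 h2), mul_zero, mul_zero, add_zero, add_zero, mul_one,
      cConst_eq]
    refine Finset.sum_congr rfl fun a ha => ?_
    obtain ⟨ha1, hak⟩ := Finset.mem_Icc.1 ha
    have hK0 : red p K ≠ 0 := fun h0 => h1 (red_eq_zero_iff.1 h0)
    have hKK : (p : ℤ) ^ 2 ∣ q.polarBilin K K := (p_sq_dvd_polar_self_iff h.odd).2 hK
    have hpart : IsPartial p q.polarBilin (Fin.cons K Fin.elim0 : Fin (0 + 1) → (Fin (2 * k + 1) → ℤ)) := by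
      rw [(isPartial_nil p _).cons_iff h.symmZ, spanRed_nil]
      exact ⟨by simpa using hK0, fun i => i.elim0, hKK⟩
    rw [← prod_totIso_one hp1 ha1 hak, ← ncard_goodThrough_totIso h hak ha1 hpart]
    · congr 2
      ext Λ
      simp only [goodThrough, Set.mem_ofPred_eq, Fin.forall_fin_succ, Fin.cons_zero, IsEmpty.forall_iff, and_true]
      constructor
      · rintro ⟨e1, e2, e3⟩
        exact ⟨e1, e1.totIso h, e3, e2⟩
      · rintro ⟨e1, -, e3, e2⟩
        exact ⟨e1, e2, e3⟩
    · rw [spanRed_cons, spanRed_nil, totIso_sup_iff h.symm totIso_bot]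
      exact ⟨by simp, h.dvd_iff.1 ((dvd_pow_self _ two_ne_zero).trans hKK)⟩
  · rw [delta, if_pos (hδ1.1 h1)]
    obtain ⟨X, rfl⟩ := h1
    have hqX : q ((p : ℤ) • X) / (p : ℤ) ^ 2 = q X := by
      rw [QuadraticMap.map_smul, smul_eq_mul, ← pow_two, Int.mul_ediv_cancel_left _ (pow_ne_zero 2 hpZ)]
    have hbX : redForm q p (red p X) (red p X) = ((2 * q X : ℤ) : ZMod p) := by rw [h.compat, polar_self]
    -- For K = pX, passing through K is a condition on the reduction of the lattice only.
    have hmem : ∀ {Λ}, IsGood p q.polarBilin Λ →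
        ((p : ℤ) • X ∈ Λ ↔ redSub p Λ ≤ (redForm q p).orthogonal (ZMod p ∙ red p X)) := fun hΛ => by
      rw [hΛ.p_smul_mem_iff h, le_orthogonal_span_singleton h.symm]
    have hfinal : ∀ S η δ : ℚ, S = cConst p k + betaConst p k + η * (p : ℚ) ^ (k - 1) * cConst p k +
        (p : ℚ) ^ (2 * k + 1 - 2) * δ * cConst p k →
        S = cConst p k * (1 + (η * (p : ℚ) ^ (k - 1) + (cConst p k)⁻¹ * betaConst p k) * 1 +
          (p : ℚ) ^ (2 * k + 1 - 2) * δ) := by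
      rintro S η δ rfl
      field_simp
      ring
    rw [hqX]
    apply hfinal
    have heps : ∀ c : ℤ, ((2 * c : ℤ) : ZMod p) = 0 → eps p c = 0 := fun c hc => by
      rw [eps, legendreSym, hc, MulChar.map_zero]
    by_cases hX0 : red p X = 0
    · have h2 : ∃ X', (p : ℤ) • X = (p : ℤ) • (p : ℤ) • X' := by
        obtain ⟨Y, rfl⟩ := red_eq_zero_iff.1 hX0
        exact ⟨Y, rfl⟩
      rw [delta, if_pos (hδ2.1 h2), heps, Int.cast_zero, zero_mul, zero_mul, zero_mul, add_zero, mul_one,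
        ← sum_totIso_zero hp1]
      · refine Finset.sum_congr rfl fun a ha => ?_
        obtain ⟨ha1, hak⟩ := Finset.mem_Icc.1 ha
        rw [← prod_totIso_zero hp1 ha1 hak, ← ncard_goodThrough_totIso h hak (Nat.zero_le a) (isPartial_nil p _)
          (by rw [spanRed_nil]; exact totIso_bot)]
        congr 2
        ext Λ
        simp only [goodThrough, Set.mem_ofPred_eq, IsEmpty.forall_iff, and_true]
        constructor
        · rintro ⟨e1, -, e3⟩
          exact ⟨e1, e1.totIso h, e3⟩
        · rintro ⟨e1, -, e3⟩
          obtain ⟨Y, hY⟩ := h2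
          exact ⟨e1, hY ▸ e1.p_sq_smul_mem Y, e3⟩
      · rw [← hbX, hX0]; simp
    · have h2 : ¬ ∃ X', (p : ℤ) • X = (p : ℤ) • (p : ℤ) • X' := by
        rintro ⟨Y, hY⟩
        exact hX0 (red_eq_zero_iff.2 ⟨Y, smul_right_injective _ hpZ hY⟩)
      rw [delta, if_neg (hδ2.not.1 h2), mul_zero, zero_mul, add_zero]
      by_cases hiso : redForm q p (red p X) (red p X) = 0
      · rw [heps _ (hbX ▸ hiso), Int.cast_zero, zero_mul, zero_mul, zero_mul, add_zero, ← sum_isotropic hp1]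
        refine Finset.sum_congr rfl fun a ha => ?_
        obtain ⟨ha1, hak⟩ := Finset.mem_Icc.1 ha
        have hpow : (p : ℚ) ^ (a - 1) * (baseProd p k a * (p : ℚ) ^ (1 - (a : ℤ))) = baseProd p k a := by
          have : (p : ℚ) ^ (1 - (a : ℤ)) = ((p : ℚ) ^ (a - 1))⁻¹ := by
            rw [← zpow_natCast, ← zpow_neg]; congr 1; omega
          rw [this]; field_simp
        -- The first summand counts the lattices whose reduction avoids X, the second those whose
        -- reduction contains X; in the latter case orthogonality to X is automatic.
        rw [← prod_isotropic hp1 ha1 hak, ← ncard_goodThrough_isotropic h hak hiso hX0]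
        rw [← hpow]
        rw [← prod_totIso_one hp1 ha1 hak, ← ncard_goodThrough_mem_redSub h ha1 hak hiso hX0, ← Nat.cast_add,
          ← Set.ncard_union_eq ?_ (finite_goodThrough _) ((finite_isGood p _).subset fun _ h => h.1)]
        · congr 2
          ext Λ
          simp only [goodThrough, Set.mem_ofPred_eq, IsEmpty.forall_iff, and_true, Set.mem_union]
          constructor
          · rintro ⟨e1, e2, e3⟩
            by_cases hXΛ : red p X ∈ redSub p Λ
            · exact Or.inr ⟨e1, hXΛ, e3⟩
            · exact Or.inl ⟨e1, ⟨⟨e1.totIso h, (hmem e1).1 e2⟩, hXΛ⟩, e3⟩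
          · rintro (⟨e1, ⟨⟨-, e2⟩, -⟩, e3⟩ | ⟨e1, e2, e3⟩)
            · exact ⟨e1, (hmem e1).2 e2, e3⟩
            · exact ⟨e1, (e1.p_smul_mem_iff h).2 ((e1.totIso h).le_orthogonal e2), e3⟩
        · rw [Set.disjoint_left]
          rintro Λ ⟨-, ⟨-, e1⟩, -⟩ ⟨-, e2, -⟩
          exact e1 e2
      · set η : ℤ := quadraticChar (ZMod p) ((-1) ^ k *
          (LinearMap.BilinForm.toMatrix (Pi.basisFun (ZMod p) (Fin (2 * k + 1))) (redForm q p)).det *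
          redForm q p (red p X) (red p X)) with hη
        have hdet : (LinearMap.BilinForm.toMatrix (Pi.basisFun (ZMod p) (Fin (2 * k + 1))) (redForm q p)).det =
            (formDet q : ZMod p) := by
          rw [LinearMap.BilinForm.toMatrix_basisFun, redForm, LinearMap.BilinForm.toMatrix'_toBilin', det_gram_map]
        have hη1 : (eps p (q X) : ℚ) * (chi q p : ℚ) = (η : ℚ) := by
          rw [← Int.cast_mul]
          congr 1
          rw [hη, hdet, hbX, eps, chi, legendreSym, legendreSym, ← map_mul, show (2 * k + 1) / 2 = k by omega]
          congr 1
          push_cast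
          ring
        have hη2 : (η : ℚ) ^ 2 = 1 := by
          have : η ^ 2 = 1 := by
            refine quadraticChar_sq_one (mul_ne_zero (mul_ne_zero (by simp) ?_) hiso)
            rw [hdet]
            rwa [Ne, ZMod.intCast_zmod_eq_zero_iff_dvd]
          exact_mod_cast this
        rw [hη1, ← sum_anisotropic hp1 hη2]
        refine Finset.sum_congr rfl fun a ha => ?_
        obtain ⟨ha1, hak⟩ := Finset.mem_Icc.1 ha
        rw [← prod_anisotropic hp1 hη2 ha1 hak, hη, ← ncard_goodThrough_anisotropic h hak hiso]
        congr 2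
        ext Λ
        simp only [goodThrough, Set.mem_ofPred_eq, IsEmpty.forall_iff, and_true]
        constructor
        · rintro ⟨e1, e2, e3⟩
          exact ⟨e1, ⟨e1.totIso h, (hmem e1).1 e2⟩, e3⟩
        · rintro ⟨e1, ⟨-, e2⟩, e3⟩
          exact ⟨e1, (hmem e1).2 e2, e3⟩

end Main

end IntQuad

/-- The condition `p ^ 2 ∣ q K` makes `q K / p ^ 2` below an exact division; its value is `q(p⁻¹ K)`. -/
theorem theorem1p11 (m k : ℕ) (hmk : m = 2 * k + 1) (hm : 3 ≤ m)
    (q : QuadraticForm ℤ (Fin m → ℤ)) (hq : IntQuad.formDet q ≠ 0)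
    (p : ℕ) [Fact p.Prime] (hp : ¬ (p : ℤ) ∣ IntQuad.formDet q)
    {ι : Type*} (r : ι → QuadraticForm ℤ (Fin m → ℤ)) (hr : IntQuad.IsCompleteSystem q r)
    (K : Fin m → ℤ) (hK : (p : ℤ) ^ 2 ∣ q K) :
    Finite (Σ i : ι, {c : IntQuad.AutClass q (r i) ((p : ℤ) ^ 2) // c.LeftDvd K}) ∧
    (Nat.card (Σ i : ι, {c : IntQuad.AutClass q (r i) ((p : ℤ) ^ 2) // c.LeftDvd K}) : ℚ) =
      IntQuad.cConst p k *
        (1 + ((IntQuad.eps p (q K / (p : ℤ) ^ 2) : ℚ) * (IntQuad.chi q p : ℚ) * (p : ℚ) ^ (k - 1)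
              + (IntQuad.cConst p k)⁻¹ * IntQuad.betaConst p k)
            * IntQuad.delta (fun i => (p : ℚ)⁻¹ * (K i : ℚ))
          + (p : ℚ) ^ (m - 2) * IntQuad.delta (fun i => ((p : ℚ) ^ 2)⁻¹ * (K i : ℚ))) := by
  subst hmk
  obtain ⟨f, hf⟩ := IntQuad.bijective_lattice (odd_two_mul_add_one k) hq hp hr K
  have hfin : Finite {Λ // IntQuad.IsGood p q.polarBilin Λ ∧ IntQuad.redSub p Λ ≠ ⊥ ∧ K ∈ Λ} :=
    ((IntQuad.finite_isGood p q.polarBilin).subset fun _ h => h.1).to_subtype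
  refine ⟨Finite.of_injective f hf.1, ?_⟩
  rw [Nat.card_eq_of_bijective f hf, ← IntQuad.ncard_through (by omega) hp hK, ← Nat.card_coe_set_eq]
  rfl
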